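/- Let $G$ be a second-countable locally compact Hausdorff groupoid with unit space $G^{(0)}$ and range and source maps $r,s$, and suppose that $G$ is principal (an arrow $\gamma$ is determined by the pair $(r(\gamma),s(\gamma))$). Let $\lambda=\{\lambda_x\}_{x\in G^{(0)}}$ be a (right) Haar system on $G$, i.e. a family of Radon measures on $G$ with $\operatorname{supp}\lambda_x=s^{-1}(x)$, such that $x\mapsto\int f\,d\lambda_x$ is in $C_c(G^{(0)})$ for every $f\in C_c(G)$, and $\int f(\alpha\gamma)\,d\lambda_{r(\gamma)}(\alpha)=\int f(\alpha)\,d\lambda_{s(\gamma)}(\alpha)$ for all $f\in C_c(G)$ and $\gamma\in G$. For $x\in G^{(0)}$ let $\mathrm L^x$ be the representation of the groupoid $C^*$-algebra $C^*(G)$ on $L^2(G,\lambda_x)$ given by $(\mathrm L^x(f)\xi)(\gamma)=\int_G f(\gamma\alpha^{-1})\xi(\alpha)\,d\lambda_x(\alpha)$ for $f\in C_c(G)$; since $G$ is principal, $\mathrm L^x$ is irreducible. For an irreducible representation $\pi$ of a $C^*$-algebra $A$ and a sequence $\{\pi_n\}$ of irreducible representations, the relative lower multiplicity is $$\mathrm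 M_{\mathrm L}(\pi,\{\pi_n\})=\inf_{N}\ \liminf_{n}\ d(\pi_n,\phi,N)\in\mathbb N\cup\{\infty\},$$ where $\phi$ is any pure state of $A$ associated with $\pi$ (the value does not depend on the choice), $N$ runs over the sets $\{\psi\in A^*:|\psi(a_i)|<\varepsilon,\ 1\le i\le m\}$ with $a_1,\dots,a_m\in A$ and $\varepsilon>0$, and $d(\sigma,\phi,N)$ is the supremum of the cardinalities of the finite orthonormal sets of unit vectors $\eta\in\mathcal H_\sigma$ with $(\sigma(\cdot)\eta\,|\,\eta)\in\phi+N$. Let $k\ge 1$ be an integer, let $z\in G^{(0)}$, and let $\{x_n\}$ be a sequence in $G^{(0)}$ that converges $k$-times in $G^{(0)}/G$ to $z$; that is, there are $k$ sequences $\{\gamma_n^{(1)}\},\dots,\{\gamma_n^{(k)}\}$ in $G$ such that $s(\gamma_n^{(i)})=x_n$ for all $n$ and $i$, $r(\gamma_n^{(i)})\to z$ as $n\to\infty$ for each $i$, and, for $1\le i<j\le k$, the sequence $\{\gamma_n^{(j)}(\gamma_n^{(i)})^{-1}\}_n$ has no convergent subsequence. Then $$\mathrm M_{\mathrm L}(\mathrm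 L^z,\{\mathrm L^{x_n}\})\ge k.$$ -/

import Mathlib

open MeasureTheory Filter Topology Set
open scoped ENNReal NNReal CompactlySupported ComplexConjugate

universe u

/-- A topological groupoid with arrow space `G` and unit space `X`. The map `unit` is a
homeomorphism of `X` onto the set of units in `G` (its inverse is the restriction of `r`), and the
product is only defined on composable pairs. -/
structure TopGroupoid (X G : Type u) [TopologicalSpace X] [TopologicalSpace G] where
  r : G → X
  s : G → X
  unit : X → G
  inv : G → G
  mul : (a b : G) → s a = r b → G
  r_unit : ∀ x, r (unit x) = x
  s_unit : ∀ x, s (unit x) = x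
  r_inv : ∀ a, r (inv a) = s a
  s_inv : ∀ a, s (inv a) = r a
  r_mul : ∀ a b h, r (mul a b h) = r a
  s_mul : ∀ a b h, s (mul a b h) = s b
  mul_assoc : ∀ (a b c : G) (hab : s a = r b) (hbc : s b = r c),
    mul (mul a b hab) c ((s_mul a b hab).trans hbc) =
      mul a (mul b c hbc) (hab.trans (r_mul b c hbc).symm)
  unit_mul : ∀ a, mul (unit (r a)) a (s_unit (r a)) = a
  mul_unit : ∀ a, mul a (unit (s a)) (r_unit (s a)).symm = a
  inv_mul : ∀ a, mul (inv a) a (s_inv a) = unit (s a)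
  mul_inv : ∀ a, mul a (inv a) (r_inv a).symm = unit (r a)
  continuous_r : Continuous r
  continuous_s : Continuous s
  continuous_unit : Continuous unit
  continuous_inv : Continuous inv
  continuous_mul : Continuous fun p : {p : G × G // s p.1 = r p.2} => mul p.1.1 p.1.2 p.2

namespace TopGroupoid

variable {X G : Type u} [TopologicalSpace X] [TopologicalSpace G] (𝒢 : TopGroupoid X G)

/-- A groupoid is principal if an arrow is determined by its range and source. -/
def IsPrincipal : Prop :=
  ∀ a b : G, 𝒢.r a = 𝒢.r b → 𝒢.s a = 𝒢.s b → a = b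

/-- The product `a b⁻¹` of two arrows with the same source. -/
def div (a b : G) (h : 𝒢.s a = 𝒢.s b) : G :=
  𝒢.mul a (𝒢.inv b) (h.trans (𝒢.r_inv b).symm)

open Classical in
/-- The function `(a, b) ↦ f (a b⁻¹)`, extended by zero to all pairs of arrows. -/
noncomputable def kern (f : G → ℂ) (a b : G) : ℂ :=
  if h : 𝒢.s a = 𝒢.s b then f (𝒢.div a b h) else 0

open Classical in
/-- Right translation `a ↦ a c`, extended by the identity to all arrows. -/
noncomputable def mulRight (c a : G) : G :=
  if h : 𝒢.s a = 𝒢.r c then 𝒢.mul a c h else a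

variable {𝒢}

theorem mul_congr {a a' b b' : G} (ha : a = a') (hb : b = b') (h : 𝒢.s a = 𝒢.r b) :
    𝒢.mul a b h = 𝒢.mul a' b' (by rw [← ha, ← hb]; exact h) := by
  subst ha; subst hb; rfl

theorem unit_mul' {x : X} (a : G) (h : 𝒢.s (𝒢.unit x) = 𝒢.r a) : 𝒢.mul (𝒢.unit x) a h = a := by
  have hx : x = 𝒢.r a := by rw [← h, 𝒢.s_unit]
  subst hx
  exact 𝒢.unit_mul a

theorem mul_unit' {x : X} (a : G) (h : 𝒢.s a = 𝒢.r (𝒢.unit x)) : 𝒢.mul a (𝒢.unit x) h = a := by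
  have hx : 𝒢.s a = x := by rw [h, 𝒢.r_unit]
  subst hx
  exact 𝒢.mul_unit a

theorem mul_mul_inv (a b : G) (h : 𝒢.s a = 𝒢.r b) (h2 : 𝒢.s (𝒢.mul a b h) = 𝒢.r (𝒢.inv b)) :
    𝒢.mul (𝒢.mul a b h) (𝒢.inv b) h2 = a := by
  rw [𝒢.mul_assoc a b (𝒢.inv b) h (𝒢.r_inv b).symm, mul_congr rfl (𝒢.mul_inv b), mul_unit']

theorem mul_inv_mul (a b : G) (h : 𝒢.s a = 𝒢.s b)
    (h2 : 𝒢.s (𝒢.div a b h) = 𝒢.r b) :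
    𝒢.mul (𝒢.div a b h) b h2 = a := by
  unfold div
  rw [𝒢.mul_assoc a (𝒢.inv b) b _ (𝒢.s_inv b), mul_congr rfl (𝒢.inv_mul b), mul_unit']

theorem eq_div {a b c : G} (h : 𝒢.s c = 𝒢.r b) (e : 𝒢.mul c b h = a) :
    c = 𝒢.div a b (by rw [← e, 𝒢.s_mul]) := by
  subst e
  exact (mul_mul_inv c b h _).symm

theorem s_div (a b : G) (h : 𝒢.s a = 𝒢.s b) : 𝒢.s (𝒢.div a b h) = 𝒢.r b := by
  rw [div, 𝒢.s_mul, 𝒢.s_inv]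

theorem r_div (a b : G) (h : 𝒢.s a = 𝒢.s b) : 𝒢.r (𝒢.div a b h) = 𝒢.r a := 𝒢.r_mul _ _ _

/-- `(a d⁻¹) (b d⁻¹)⁻¹ = a b⁻¹`. -/
theorem div_div_div (a b d : G) (ha : 𝒢.s a = 𝒢.s d) (hb : 𝒢.s b = 𝒢.s d)
    (h : 𝒢.s (𝒢.div a d ha) = 𝒢.s (𝒢.div b d hb)) :
    𝒢.div (𝒢.div a d ha) (𝒢.div b d hb) h = 𝒢.div a b (ha.trans hb.symm) := by
  have h1 : 𝒢.s (𝒢.div a b (ha.trans hb.symm)) = 𝒢.r (𝒢.div b d hb) := by rw [s_div, r_div]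
  have h2 : 𝒢.mul (𝒢.div a b (ha.trans hb.symm)) (𝒢.div b d hb) h1 = 𝒢.div a d ha :=
    (𝒢.mul_assoc (𝒢.div a b (ha.trans hb.symm)) b (𝒢.inv d) (s_div _ _ _)
      (hb.trans (𝒢.r_inv d).symm)).symm.trans
      (mul_congr (mul_inv_mul a b (ha.trans hb.symm) (s_div _ _ _)) rfl _)
  exact (eq_div h1 h2).symm

theorem inv_eq_of_mul {a b : G} (h : 𝒢.s a = 𝒢.r b) (e : 𝒢.mul a b h = 𝒢.unit (𝒢.r a)) :
    𝒢.inv b = a := by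
  have h1 := mul_mul_inv a b h (by rw [𝒢.s_mul, 𝒢.r_inv])
  rw [← h1, mul_congr e rfl, unit_mul']

theorem inv_inv (𝒢 : TopGroupoid X G) (a : G) : 𝒢.inv (𝒢.inv a) = a :=
  inv_eq_of_mul (𝒢.r_inv a).symm (𝒢.mul_inv a)

/-- `(a b⁻¹)⁻¹ = b a⁻¹`. -/
theorem inv_div (a b : G) (h : 𝒢.s a = 𝒢.s b) :
    𝒢.inv (𝒢.div a b h) = 𝒢.div b a h.symm := by
  have hc : 𝒢.s (𝒢.div b a h.symm) = 𝒢.r (𝒢.div a b h) := by rw [s_div, r_div]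
  refine inv_eq_of_mul hc ?_
  have h2 : 𝒢.mul (𝒢.div b a h.symm) (𝒢.div a b h) hc = 𝒢.mul b (𝒢.inv b) (𝒢.r_inv b).symm :=
    (𝒢.mul_assoc (𝒢.div b a h.symm) a (𝒢.inv b) (s_div _ _ _)
      (h.trans (𝒢.r_inv b).symm)).symm.trans
      (mul_congr (mul_inv_mul b a h.symm (s_div _ _ _)) rfl _)
  rw [h2, 𝒢.mul_inv, r_div]

theorem kern_of_eq {f : G → ℂ} {a b : G} (h : 𝒢.s a = 𝒢.s b) :
    𝒢.kern f a b = f (𝒢.div a b h) := dif_pos h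

theorem kern_of_ne {f : G → ℂ} {a b : G} (h : 𝒢.s a ≠ 𝒢.s b) :
    𝒢.kern f a b = 0 := dif_neg h

theorem kern_eq_mulRight {f : G → ℂ} {a b : G} (h : 𝒢.s a = 𝒢.s b) :
    𝒢.kern f a b = f (𝒢.mulRight (𝒢.inv b) a) := by
  rw [kern_of_eq h, mulRight, dif_pos (by rw [h, 𝒢.r_inv])]
  rfl

theorem kern_star (f : G → ℂ) (a b : G) :
    𝒢.kern (fun c => conj (f (𝒢.inv c))) a b = conj (𝒢.kern f b a) := by
  by_cases h : 𝒢.s a = 𝒢.s b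
  · rw [kern_of_eq h, kern_of_eq h.symm, inv_div]
  · rw [kern_of_ne h, kern_of_ne (fun e => h e.symm), map_zero]

theorem kern_kern {f : G → ℂ} {a b d : G} (ha : 𝒢.s a = 𝒢.s d) (hb : 𝒢.s b = 𝒢.s d) :
    𝒢.kern f (𝒢.div a d ha) (𝒢.div b d hb) = 𝒢.kern f a b := by
  rw [kern_of_eq (by rw [s_div, s_div]), kern_of_eq (ha.trans hb.symm), div_div_div]

theorem continuous_div :
    Continuous fun p : {p : G × G // 𝒢.s p.1 = 𝒢.s p.2} => 𝒢.div p.1.1 p.1.2 p.2 := by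
  unfold div
  exact 𝒢.continuous_mul.comp (Continuous.subtype_mk
    (f := fun p : {p : G × G // 𝒢.s p.1 = 𝒢.s p.2} => (p.1.1, 𝒢.inv p.1.2))
    ((continuous_fst.comp continuous_subtype_val).prodMk
      (𝒢.continuous_inv.comp (continuous_snd.comp continuous_subtype_val)))
    (fun p => p.2.trans (𝒢.r_inv p.1.2).symm))

theorem t2Space_units [T2Space G] (𝒢 : TopGroupoid X G) : T2Space X :=
  T2Space.of_injective_continuous (Function.LeftInverse.injective 𝒢.r_unit) 𝒢.continuous_unit

theorem isClosed_eq_s [T2Space G] : IsClosed {p : G × G | 𝒢.s p.1 = 𝒢.s p.2} := by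
  have := 𝒢.t2Space_units
  exact isClosed_eq (𝒢.continuous_s.comp continuous_fst) (𝒢.continuous_s.comp continuous_snd)

end TopGroupoid

set_option linter.unusedSectionVars false

section HaarSystem

variable {X G : Type u} [TopologicalSpace X] [TopologicalSpace G] [MeasurableSpace G]

open Classical in
/-- A right Haar system: Radon measures `λ_x` on `G` with support `s⁻¹{x}`, depending continuously
on `x`, with `∫ f(ac) dλ_{r(c)}(a) = ∫ f(a) dλ_{s(c)}(a)` for all arrows `c`. The integrand on the
left is only defined on `s⁻¹{r(c)}`, which carries `λ_{r(c)}`; it is set to `0` elsewhere. -/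
structure HaarSystem (𝒢 : TopGroupoid X G) where
  measure : X → Measure G
  regular : ∀ x, (measure x).Regular
  support_eq : ∀ x, (measure x).support = {a | 𝒢.s a = x}
  continuous_integral : ∀ f : C_c(G, ℂ), Continuous fun x => ∫ a, f a ∂(measure x)
  hasCompactSupport_integral : ∀ f : C_c(G, ℂ), HasCompactSupport fun x => ∫ a, f a ∂(measure x)
  invariant : ∀ (f : C_c(G, ℂ)) (c : G),
    ∫ a, (if h : 𝒢.s a = 𝒢.r c then f (𝒢.mul a c h) else 0) ∂(measure (𝒢.r c)) =
      ∫ a, f a ∂(measure (𝒢.s c))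

namespace HaarSystem

variable [BorelSpace G] [T2Space G] [LocallyCompactSpace G] [SecondCountableTopology G]
  {𝒢 : TopGroupoid X G} (L : HaarSystem 𝒢)

instance (x : X) : (L.measure x).Regular := L.regular x


theorem ae_s_eq (x : X) : ∀ᵐ a ∂(L.measure x), 𝒢.s a = x := by
  have := Measure.support_mem_ae (μ := L.measure x)
  rw [L.support_eq] at this
  exact this

theorem measurable_kern {f : G → ℂ} (hf : Continuous f) :
    Measurable fun p : G × G => 𝒢.kern f p.1 p.2 := by
  classical
  have hD : MeasurableSet {p : G × G | 𝒢.s p.1 = 𝒢.s p.2} := 𝒢.isClosed_eq_s.measurableSet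
  refine measurable_of_restrict_of_restrict_compl hD ?_ ?_
  · have h : Measurable fun p : {p : G × G // 𝒢.s p.1 = 𝒢.s p.2} => f (𝒢.div p.1.1 p.1.2 p.2) :=
      (hf.comp TopGroupoid.continuous_div).measurable
    convert! h using 1
    exact funext fun p => TopGroupoid.kern_of_eq p.2
  · convert! measurable_const (a := (0 : ℂ)) using 1
    exact funext fun p => TopGroupoid.kern_of_ne p.2

theorem measurable_mulRight (c : G) : Measurable (𝒢.mulRight c) := by
  classical
  have := 𝒢.t2Space_units
  have hD : MeasurableSet {a : G | 𝒢.s a = 𝒢.r c} :=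
    (isClosed_eq 𝒢.continuous_s continuous_const).measurableSet
  refine measurable_of_restrict_of_restrict_compl hD ?_ ?_
  · have h : Measurable fun a : {a : G // 𝒢.s a = 𝒢.r c} => 𝒢.mul a.1 c a.2 :=
      (𝒢.continuous_mul.comp (Continuous.subtype_mk
        (f := fun a : {a : G // 𝒢.s a = 𝒢.r c} => (a.1, c))
        (continuous_subtype_val.prodMk continuous_const) (fun a => a.2))).measurable
    convert! h using 1
    exact funext fun a => dif_pos a.2
  · have h : Measurable fun a : ({a : G | 𝒢.s a = 𝒢.r c}ᶜ : Set G) => (a : G) :=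
      measurable_subtype_coe
    convert! h using 1
    exact funext fun a => dif_neg a.2

theorem mulRight_inv_mulRight {c a : G} (h : 𝒢.s a = 𝒢.r c) :
    𝒢.mulRight (𝒢.inv c) (𝒢.mulRight c a) = a := by
  have h1 : 𝒢.mulRight c a = 𝒢.mul a c h := dif_pos h
  have h2 : 𝒢.s (𝒢.mul a c h) = 𝒢.r (𝒢.inv c) := by rw [𝒢.s_mul, 𝒢.r_inv]
  rw [h1, TopGroupoid.mulRight, dif_pos h2, TopGroupoid.mul_mul_inv]

/-- Invariance of the Haar system, for measures. -/
theorem map_mulRight (c : G) :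
    (L.measure (𝒢.r c)).map (𝒢.mulRight c) = L.measure (𝒢.s c) := by
  classical
  have := 𝒢.t2Space_units
  have hm := measurable_mulRight (𝒢 := 𝒢) c
  have hfin : IsFiniteMeasureOnCompacts ((L.measure (𝒢.r c)).map (𝒢.mulRight c)) := by
    refine ⟨fun K hK => ?_⟩
    rw [Measure.map_apply hm hK.measurableSet]
    have hK2 : IsCompact (K ∩ {a | 𝒢.s a = 𝒢.r (𝒢.inv c)}) :=
      hK.inter_right (isClosed_eq 𝒢.continuous_s continuous_const)
    have hc : ContinuousOn (𝒢.mulRight (𝒢.inv c)) {a | 𝒢.s a = 𝒢.r (𝒢.inv c)} := by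
      rw [continuousOn_iff_continuous_domRestrict]
      have : Continuous fun a : {a : G // 𝒢.s a = 𝒢.r (𝒢.inv c)} => 𝒢.mul a.1 (𝒢.inv c) a.2 :=
        𝒢.continuous_mul.comp (Continuous.subtype_mk
          (f := fun a : {a : G // 𝒢.s a = 𝒢.r (𝒢.inv c)} => (a.1, 𝒢.inv c))
          (continuous_subtype_val.prodMk continuous_const) (fun a => a.2))
      refine this.congr fun a => ?_
      exact (dif_pos a.2).symm
    have hK3 := hK2.image_of_continuousOn (hc.mono inter_subset_right)
    refine lt_of_le_of_lt (measure_mono_ae ?_) hK3.measure_lt_top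
    filter_upwards [L.ae_s_eq (𝒢.r c)] with a ha haK
    refine ⟨𝒢.mulRight c a, ⟨haK, ?_⟩, mulRight_inv_mulRight ha⟩
    have h1 : 𝒢.mulRight c a = 𝒢.mul a c ha := dif_pos ha
    change 𝒢.s _ = _
    rw [h1, 𝒢.s_mul, 𝒢.r_inv]
  refine Measure.ext_of_integral_eq_on_compactlySupported fun f => ?_
  rw [integral_map (f := f) hm.aemeasurable f.continuous.aestronglyMeasurable]
  let F : C_c(G, ℂ) := f.compLeft (⟨fun t => (t : ℂ), Complex.continuous_ofReal⟩ : C(ℝ, ℂ))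
  have hF : ∀ a, F a = (f a : ℂ) := fun a =>
    CompactlySupportedContinuousMap.compLeft_apply (by simp) f a
  have h := L.invariant F c
  simp only [hF] at h
  have h3 : ∫ a, ((f (𝒢.mulRight c a) : ℝ) : ℂ) ∂(L.measure (𝒢.r c)) =
      ∫ a, ((f a : ℝ) : ℂ) ∂(L.measure (𝒢.s c)) := by
    rw [← h]
    refine integral_congr_ae ?_
    filter_upwards [L.ae_s_eq (𝒢.r c)] with a ha
    rw [dif_pos ha, TopGroupoid.mulRight, dif_pos ha]
  rw [integral_complex_ofReal, integral_complex_ofReal] at h3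
  exact_mod_cast h3

theorem lintegral_mulRight (c : G) {f : G → ℝ≥0∞} (hf : Measurable f) :
    ∫⁻ a, f (𝒢.mulRight c a) ∂(L.measure (𝒢.r c)) = ∫⁻ a, f a ∂(L.measure (𝒢.s c)) := by
  rw [← L.map_mulRight c, lintegral_map hf (measurable_mulRight c)]

/-- The convolution `(f ∗ g)(a) = ∫ f(ab⁻¹) g(b) dλ_{s(a)}(b)`. -/
noncomputable def convFun (f g : G → ℂ) (a : G) : ℂ :=
  ∫ b, 𝒢.kern f a b * g b ∂(L.measure (𝒢.s a))

theorem continuous_convFun (f g : C_c(G, ℂ)) : Continuous (L.convFun f g) := by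
  classical
  obtain ⟨χ, hχ1, -, hχ, hχ01⟩ := exists_continuous_one_zero_of_isCompact
    (s := tsupport g) (t := ∅) g.hasCompactSupport isClosed_empty (disjoint_empty _)
  let D : Set (G × G) := {p : G × G | 𝒢.s p.1 = 𝒢.s p.2}
  let k : C(D, ℂ) := ⟨fun p => f (𝒢.div p.1.1 p.1.2 p.2) * g p.1.2,
    (f.continuous.comp TopGroupoid.continuous_div).mul
      (g.continuous.comp (continuous_snd.comp continuous_subtype_val))⟩
  obtain ⟨F, hF⟩ := ContinuousMap.exists_extension
    (𝒢.isClosed_eq_s.isClosedEmbedding_subtypeVal) k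
  have hFk : ∀ a b (h : 𝒢.s a = 𝒢.s b), F (a, b) = f (𝒢.div a b h) * g b := fun a b h =>
    congrArg (fun φ : C(D, ℂ) => φ ⟨(a, b), h⟩) hF
  let cut : (G → ℂ) → (G → ℂ) := fun u b => u b * ((χ b : ℝ) : ℂ)
  have hcutc : ∀ u : C(G, ℂ), HasCompactSupport (cut u) := fun u =>
    HasCompactSupport.mul_left (f := u) (hχ.comp_left (g := fun t : ℝ => (t : ℂ)) (by simp))
  have hcutcont : ∀ u : C(G, ℂ), Continuous (cut u) := fun u =>
    u.continuous.mul (Complex.continuous_ofReal.comp χ.continuous)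
  let cutC : C(G, ℂ) → C_c(G, ℂ) := fun u => ⟨⟨cut u, hcutcont u⟩, hcutc u⟩
  have key : ∀ a, L.convFun f g a = ∫ b, cut (F.curry a) b ∂(L.measure (𝒢.s a)) := by
    intro a
    refine integral_congr_ae ?_
    filter_upwards [L.ae_s_eq (𝒢.s a)] with b hb
    change _ = F (a, b) * ((χ b : ℝ) : ℂ)
    rw [TopGroupoid.kern_of_eq hb.symm, hFk a b hb.symm]
    by_cases hg : b ∈ tsupport g
    · rw [hχ1 hg]; simp
    · rw [image_eq_zero_of_notMem_tsupport hg]; simp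
  have hK : IsCompact (tsupport χ) := hχ
  let χC : C_c(G, ℂ) := cutC 1
  have hint : ∀ x (u : C(G, ℂ)), Integrable (cut u) (L.measure x) := fun x u =>
    (hcutcont u).integrable_of_hasCompactSupport (hcutc u)
  rw [continuous_iff_continuousAt]
  intro a₀
  rw [Metric.continuousAt_iff']
  intro ε hε
  set M : ℝ := ‖∫ b, χC b ∂(L.measure (𝒢.s a₀))‖ + 1 with hM
  have hMpos : 0 < M := by positivity
  have e1 : ∀ᶠ a in 𝓝 a₀, ‖∫ b, χC b ∂(L.measure (𝒢.s a))‖ < M := by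
    have : ContinuousAt (fun a => ‖∫ b, χC b ∂(L.measure (𝒢.s a))‖) a₀ :=
      ((L.continuous_integral χC).comp 𝒢.continuous_s).norm.continuousAt
    exact this.eventually_lt continuousAt_const (by linarith)
  have e2 : ∀ᶠ a in 𝓝 a₀, dist (∫ b, cut (F.curry a₀) b ∂(L.measure (𝒢.s a)))
      (∫ b, cut (F.curry a₀) b ∂(L.measure (𝒢.s a₀))) < ε / 2 := by
    have : ContinuousAt (fun a => ∫ b, cut (F.curry a₀) b ∂(L.measure (𝒢.s a))) a₀ :=
      ((L.continuous_integral (cutC (F.curry a₀))).comp 𝒢.continuous_s).continuousAt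
    exact Metric.continuousAt_iff'.1 this _ (half_pos hε)
  have e3 : ∀ᶠ a in 𝓝 a₀, ∀ b ∈ tsupport χ, dist (F (a, b)) (F (a₀, b)) < ε / (2 * M) := by
    have hc : ContinuousAt (fun a => F.curry a) a₀ := F.curry.continuous.continuousAt
    have := (ContinuousMap.tendsto_iff_forall_isCompact_tendstoUniformlyOn.1 hc) _ hK
    have := Metric.tendstoUniformlyOn_iff.1 this (ε / (2 * M)) (by positivity)
    filter_upwards [this] with a ha b hb
    rw [dist_comm]; exact ha b hb
  filter_upwards [e1, e2, e3] with a h1 h2 h3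
  rw [key, key]
  refine lt_of_le_of_lt (dist_triangle _ (∫ b, cut (F.curry a₀) b ∂(L.measure (𝒢.s a))) _) ?_
  have h4 : dist (∫ b, cut (F.curry a) b ∂(L.measure (𝒢.s a)))
      (∫ b, cut (F.curry a₀) b ∂(L.measure (𝒢.s a))) ≤ ε / 2 := by
    rw [dist_eq_norm, ← integral_sub (hint _ _) (hint _ _)]
    have hχint : ∫ b, χC b ∂(L.measure (𝒢.s a)) = ((∫ b, χ b ∂(L.measure (𝒢.s a)) : ℝ) : ℂ) := by
      rw [← integral_complex_ofReal]
      refine integral_congr_ae (Eventually.of_forall fun b => ?_)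
      change (1 : ℂ) * _ = _
      rw [one_mul]
    have hχi : Integrable (fun b => χ b) (L.measure (𝒢.s a)) :=
      χ.continuous.integrable_of_hasCompactSupport hχ
    have hχM : ∫ b, χ b ∂(L.measure (𝒢.s a)) ≤ M := by
      rw [hχint, Complex.norm_real] at h1
      exact (le_abs_self _).trans h1.le
    calc ‖∫ b, (cut (F.curry a) b - cut (F.curry a₀) b) ∂(L.measure (𝒢.s a))‖
        ≤ ∫ b, ε / (2 * M) * χ b ∂(L.measure (𝒢.s a)) := by
          refine norm_integral_le_of_norm_le (hχi.const_mul _) (Eventually.of_forall fun b => ?_)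
          change ‖F (a, b) * ((χ b : ℝ) : ℂ) - F (a₀, b) * ((χ b : ℝ) : ℂ)‖ ≤ _
          rw [← sub_mul, norm_mul, Complex.norm_real, Real.norm_of_nonneg (hχ01 b).1]
          by_cases hb : b ∈ tsupport χ
          · have := (h3 b hb).le
            rw [dist_eq_norm] at this
            exact mul_le_mul_of_nonneg_right this (hχ01 b).1
          · rw [image_eq_zero_of_notMem_tsupport hb]; simp
      _ = ε / (2 * M) * ∫ b, χ b ∂(L.measure (𝒢.s a)) := integral_const_mul _ _
      _ ≤ ε / (2 * M) * M := by gcongr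
      _ = ε / 2 := by field_simp
  linarith

theorem hasCompactSupport_convFun (f g : C_c(G, ℂ)) : HasCompactSupport (L.convFun f g) := by
  classical
  have := 𝒢.t2Space_units
  have hS : IsCompact {p : {p : G × G // 𝒢.s p.1 = 𝒢.r p.2} |
      p.1 ∈ tsupport f ×ˢ tsupport g} := by
    have hcl : IsClosed {p : G × G | 𝒢.s p.1 = 𝒢.r p.2} :=
      isClosed_eq (𝒢.continuous_s.comp continuous_fst) (𝒢.continuous_r.comp continuous_snd)
    exact hcl.isClosedEmbedding_subtypeVal.isCompact_preimage
      (f.hasCompactSupport.isCompact.prod g.hasCompactSupport.isCompact)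
  refine HasCompactSupport.intro (hS.image 𝒢.continuous_mul) fun a ha => ?_
  refine integral_eq_zero_of_ae ?_
  filter_upwards [L.ae_s_eq (𝒢.s a)] with b hb
  rw [TopGroupoid.kern_of_eq hb.symm]
  by_contra hne
  have hf : f (𝒢.div a b hb.symm) ≠ 0 := fun e => hne (by simp [e])
  have hg : g b ≠ 0 := fun e => hne (by simp [e])
  refine ha ⟨⟨(𝒢.div a b hb.symm, b), TopGroupoid.s_div a b hb.symm⟩, ⟨?_, ?_⟩, ?_⟩
  · exact subset_tsupport _ hf
  · exact subset_tsupport _ hg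
  · exact TopGroupoid.mul_inv_mul a b hb.symm (TopGroupoid.s_div a b hb.symm)

/-- The convolution product on `C_c(G)`. -/
noncomputable def conv (f g : C_c(G, ℂ)) : C_c(G, ℂ) :=
  ⟨⟨L.convFun f g, L.continuous_convFun f g⟩, L.hasCompactSupport_convFun f g⟩

end HaarSystem

/-- The involution `f*(a) = conj (f(a⁻¹))` on `C_c(G)`. -/
noncomputable def TopGroupoid.invol [T2Space G] (𝒢 : TopGroupoid X G) (f : C_c(G, ℂ)) :
    C_c(G, ℂ) :=
  ⟨⟨fun a => conj (f (𝒢.inv a)), Complex.continuous_conj.comp (f.continuous.comp 𝒢.continuous_inv)⟩,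
    HasCompactSupport.intro (f.hasCompactSupport.isCompact.image 𝒢.continuous_inv) fun a ha => by
      by_contra hne
      have hf : f (𝒢.inv a) ≠ 0 := fun e => hne (by simp [e])
      exact ha ⟨𝒢.inv a, subset_tsupport _ hf, 𝒢.inv_inv a⟩⟩

end HaarSystem

section Schur

variable {Ω : Type u} [MeasurableSpace Ω] {μ : Measure Ω} [SigmaFinite μ]

theorem schur_pointwise {k u : Ω → ℝ≥0∞} (hk : AEMeasurable k μ) (hu : AEMeasurable u μ) :
    (∫⁻ b, k b * u b ∂μ) ^ (2 : ℝ) ≤ (∫⁻ b, k b ∂μ) * ∫⁻ b, k b * u b ^ (2 : ℝ) ∂μ := by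
  have h := ENNReal.lintegral_mul_le_Lp_mul_Lq μ Real.HolderConjugate.two_two
    (f := fun b => k b ^ (1 / 2 : ℝ)) (g := fun b => k b ^ (1 / 2 : ℝ) * u b)
    (hk.pow_const _) ((hk.pow_const _).mul hu)
  have e0 : ∀ t : ℝ≥0∞, t ^ (1 / 2 : ℝ) * t ^ (1 / 2 : ℝ) = t := fun t => by
    rw [← ENNReal.rpow_add_of_nonneg _ _ (by norm_num) (by norm_num)]; norm_num
  have e1 : ∀ t : ℝ≥0∞, (t ^ (1 / 2 : ℝ)) ^ (2 : ℝ) = t := fun t => by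
    rw [← ENNReal.rpow_mul]; norm_num
  have e2 : ∀ b, (fun b => k b ^ (1 / 2 : ℝ)) b ^ (2 : ℝ) = k b := fun b => e1 _
  have e3 : ∀ b, (fun b => k b ^ (1 / 2 : ℝ) * u b) b ^ (2 : ℝ) = k b * u b ^ (2 : ℝ) := fun b => by
    change (k b ^ (1 / 2 : ℝ) * u b) ^ (2 : ℝ) = _
    rw [ENNReal.mul_rpow_of_nonneg _ _ (by norm_num), e1]
  have e4 : ∀ b, ((fun b => k b ^ (1 / 2 : ℝ)) * fun b => k b ^ (1 / 2 : ℝ) * u b) b = k b * u b :=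
    fun b => by
      change k b ^ (1 / 2 : ℝ) * (k b ^ (1 / 2 : ℝ) * u b) = _
      rw [← mul_assoc, e0]
  simp only [e2, e3, e4] at h
  refine (ENNReal.rpow_le_rpow h (by norm_num : (0 : ℝ) ≤ 2)).trans ?_
  rw [ENNReal.mul_rpow_of_nonneg _ _ (by norm_num), e1, e1]

theorem schur_lintegral {k : Ω → Ω → ℝ≥0∞} (hk : Measurable (Function.uncurry k)) {C : ℝ≥0∞}
    (h1 : ∀ᵐ a ∂μ, ∫⁻ b, k a b ∂μ ≤ C) (h2 : ∀ᵐ b ∂μ, ∫⁻ a, k a b ∂μ ≤ C)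
    {u : Ω → ℝ≥0∞} (hu : AEMeasurable u μ) :
    ∫⁻ a, (∫⁻ b, k a b * u b ∂μ) ^ (2 : ℝ) ∂μ ≤ C ^ (2 : ℝ) * ∫⁻ b, u b ^ (2 : ℝ) ∂μ := by
  have hka : ∀ a, Measurable (k a) := fun a => hk.comp measurable_prodMk_left
  have hkb : ∀ b, Measurable fun a => k a b := fun b => hk.comp measurable_prodMk_right
  have hm : AEMeasurable (Function.uncurry fun a b => k a b * u b ^ (2 : ℝ)) (μ.prod μ) :=
    hk.aemeasurable.mul ((hu.pow_const _).comp_quasiMeasurePreserving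
      Measure.quasiMeasurePreserving_snd)
  calc ∫⁻ a, (∫⁻ b, k a b * u b ∂μ) ^ (2 : ℝ) ∂μ
      ≤ ∫⁻ a, C * ∫⁻ b, k a b * u b ^ (2 : ℝ) ∂μ ∂μ := by
        refine lintegral_mono_ae ?_
        filter_upwards [h1] with a ha
        exact (schur_pointwise (hka a).aemeasurable hu).trans (by gcongr)
    _ = C * ∫⁻ a, ∫⁻ b, k a b * u b ^ (2 : ℝ) ∂μ ∂μ := by
        have hm2 : AEMeasurable (fun a => ∫⁻ b, k a b * u b ^ (2 : ℝ) ∂μ) μ :=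
          hm.lintegral_prod_right'
        rw [lintegral_const_mul'' _ hm2]
    _ = C * ∫⁻ b, ∫⁻ a, k a b * u b ^ (2 : ℝ) ∂μ ∂μ := by rw [lintegral_lintegral_swap hm]
    _ = C * ∫⁻ b, (∫⁻ a, k a b ∂μ) * u b ^ (2 : ℝ) ∂μ := by
        congr 1
        exact lintegral_congr fun b => lintegral_mul_const _ (hkb b)
    _ ≤ C * ∫⁻ b, C * u b ^ (2 : ℝ) ∂μ := by
        gcongr 1
        refine lintegral_mono_ae ?_
        filter_upwards [h2] with b hb
        gcongr
    _ = C ^ (2 : ℝ) * ∫⁻ b, u b ^ (2 : ℝ) ∂μ := by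
        rw [lintegral_const_mul'' _ (hu.pow_const _), ← mul_assoc]
        congr 1
        rw [show (2 : ℝ) = ((2 : ℕ) : ℝ) by norm_num, ENNReal.rpow_natCast, sq]

/-- A measurable kernel satisfying the hypotheses of the Schur test with constant `C`. -/
structure IsSchurKernel (μ : Measure Ω) (C : ℝ≥0) (k : Ω → Ω → ℂ) : Prop where
  measurable : Measurable (Function.uncurry k)
  left : ∀ᵐ a ∂μ, ∫⁻ b, ‖k a b‖ₑ ∂μ ≤ C
  right : ∀ᵐ b ∂μ, ∫⁻ a, ‖k a b‖ₑ ∂μ ≤ C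

namespace IsSchurKernel

variable {C : ℝ≥0} {k : Ω → Ω → ℂ}

theorem abs_bound (hk : IsSchurKernel μ C k) {ξ : Ω → ℂ} (hξ : AEStronglyMeasurable ξ μ) :
    ∫⁻ a, (∫⁻ b, ‖k a b‖ₑ * ‖ξ b‖ₑ ∂μ) ^ (2 : ℝ) ∂μ ≤
      (C : ℝ≥0∞) ^ (2 : ℝ) * ∫⁻ b, ‖ξ b‖ₑ ^ (2 : ℝ) ∂μ :=
  schur_lintegral (k := fun a b => ‖k a b‖ₑ) hk.measurable.enorm hk.left hk.right hξ.enorm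

theorem lintegral_sq_eq {ξ : Ω → ℂ} : eLpNorm ξ 2 μ = (∫⁻ b, ‖ξ b‖ₑ ^ (2 : ℝ) ∂μ) ^ (1 / 2 : ℝ) := by
  rw [eLpNorm_eq_lintegral_rpow_enorm_toReal (by norm_num) (by norm_num)]
  norm_num

theorem lintegral_sq_lt_top {ξ : Ω → ℂ} (hξ : MemLp ξ 2 μ) : ∫⁻ b, ‖ξ b‖ₑ ^ (2 : ℝ) ∂μ < ∞ := by
  have h := hξ.2
  rw [lintegral_sq_eq] at h
  by_contra hne
  rw [not_lt, top_le_iff] at hne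
  rw [hne, ENNReal.top_rpow_of_pos (by norm_num)] at h
  exact lt_irrefl _ h

theorem aestronglyMeasurable_apply (hk : IsSchurKernel μ C k) {ξ : Ω → ℂ}
    (hξ : AEStronglyMeasurable ξ μ) :
    AEStronglyMeasurable (fun p : Ω × Ω => k p.1 p.2 * ξ p.2) (μ.prod μ) :=
  (hk.measurable.aestronglyMeasurable (μ := μ.prod μ)).mul hξ.comp_snd

/-- The integral operator `(Tξ)(a) = ∫ k(a,b) ξ(b) dμ(b)` on functions. -/
noncomputable def applyFun (μ : Measure Ω) (k : Ω → Ω → ℂ) (ξ : Ω → ℂ) (a : Ω) : ℂ :=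
  ∫ b, k a b * ξ b ∂μ

theorem ae_lt_top (hk : IsSchurKernel μ C k) {ξ : Ω → ℂ} (hξ : MemLp ξ 2 μ) :
    ∀ᵐ a ∂μ, ∫⁻ b, ‖k a b‖ₑ * ‖ξ b‖ₑ ∂μ < ∞ := by
  have h := hk.abs_bound hξ.1
  have hfin : ∫⁻ a, (∫⁻ b, ‖k a b‖ₑ * ‖ξ b‖ₑ ∂μ) ^ (2 : ℝ) ∂μ ≠ ∞ := by
    refine (h.trans_lt (ENNReal.mul_lt_top ?_ (lintegral_sq_lt_top hξ))).ne
    exact ENNReal.rpow_lt_top_of_nonneg (by norm_num) ENNReal.coe_ne_top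
  have hm : AEMeasurable (fun a => (∫⁻ b, ‖k a b‖ₑ * ‖ξ b‖ₑ ∂μ) ^ (2 : ℝ)) μ := by
    refine AEMeasurable.pow_const ?_ _
    have := (hk.aestronglyMeasurable_apply hξ.1).enorm.lintegral_prod_right'
    simpa only [enorm_mul] using this
  filter_upwards [ae_lt_top' hm hfin] with a ha
  by_contra hne
  rw [not_lt, top_le_iff] at hne
  rw [hne, ENNReal.top_rpow_of_pos (by norm_num)] at ha
  exact lt_irrefl _ ha

theorem ae_integrable (hk : IsSchurKernel μ C k) {ξ : Ω → ℂ} (hξ : MemLp ξ 2 μ) :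
    ∀ᵐ a ∂μ, Integrable (fun b => k a b * ξ b) μ := by
  filter_upwards [hk.ae_lt_top hξ] with a ha
  refine ⟨(hk.measurable.comp measurable_prodMk_left).aestronglyMeasurable.mul hξ.1, ?_⟩
  rw [hasFiniteIntegral_iff_enorm]
  simpa only [enorm_mul] using ha

theorem eLpNorm_applyFun_le (hk : IsSchurKernel μ C k) {ξ : Ω → ℂ} (hξ : MemLp ξ 2 μ) :
    eLpNorm (applyFun μ k ξ) 2 μ ≤ C * eLpNorm ξ 2 μ := by
  rw [lintegral_sq_eq, lintegral_sq_eq]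
  have h : ∫⁻ a, ‖applyFun μ k ξ a‖ₑ ^ (2 : ℝ) ∂μ ≤
      (C : ℝ≥0∞) ^ (2 : ℝ) * ∫⁻ b, ‖ξ b‖ₑ ^ (2 : ℝ) ∂μ := by
    refine le_trans (lintegral_mono fun a => ?_) (hk.abs_bound hξ.1)
    refine ENNReal.rpow_le_rpow ?_ (by norm_num)
    refine (enorm_integral_le_lintegral_enorm _).trans ?_
    simp only [enorm_mul, le_refl]
  refine (ENNReal.rpow_le_rpow h (by norm_num : (0 : ℝ) ≤ 1 / 2)).trans ?_
  rw [ENNReal.mul_rpow_of_nonneg _ _ (by norm_num), ← ENNReal.rpow_mul]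
  norm_num

theorem memLp_applyFun (hk : IsSchurKernel μ C k) {ξ : Ω → ℂ} (hξ : MemLp ξ 2 μ) :
    MemLp (applyFun μ k ξ) 2 μ :=
  ⟨(hk.aestronglyMeasurable_apply hξ.1).integral_prod_right',
    (hk.eLpNorm_applyFun_le hξ).trans_lt (ENNReal.mul_lt_top ENNReal.coe_lt_top hξ.2)⟩

theorem applyFun_congr {ξ η : Ω → ℂ} (h : ξ =ᵐ[μ] η) : applyFun μ k ξ = applyFun μ k η := by
  funext a
  refine integral_congr_ae ?_
  filter_upwards [h] with b hb
  rw [hb]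

/-- The bounded operator on `L²(μ)` given by a Schur kernel. -/
noncomputable def op (hk : IsSchurKernel μ C k) : Lp ℂ 2 μ →L[ℂ] Lp ℂ 2 μ :=
  LinearMap.mkContinuous
    { toFun := fun ξ => (hk.memLp_applyFun (Lp.memLp ξ)).toLp _
      map_add' := fun ξ η => by
        rw [← MemLp.toLp_add]
        refine MemLp.toLp_congr _ _ ?_
        filter_upwards [hk.ae_integrable (Lp.memLp ξ), hk.ae_integrable (Lp.memLp η)] with a h1 h2
        rw [applyFun_congr (Lp.coeFn_add ξ η), Pi.add_apply]
        simp only [applyFun, Pi.add_apply, mul_add]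
        exact integral_add h1 h2
      map_smul' := fun c ξ => by
        rw [RingHom.id_apply, ← MemLp.toLp_const_smul]
        refine MemLp.toLp_congr _ _ (Eventually.of_forall fun a => ?_)
        rw [applyFun_congr (Lp.coeFn_smul c ξ), Pi.smul_apply, smul_eq_mul]
        simp only [applyFun, Pi.smul_apply, smul_eq_mul]
        rw [← integral_const_mul]
        exact integral_congr_ae (Eventually.of_forall fun b => by ring) }
    (C : ℝ) fun ξ => by
      change ‖(hk.memLp_applyFun (Lp.memLp ξ)).toLp _‖ ≤ _
      rw [Lp.norm_toLp, Lp.norm_def]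
      have h := ENNReal.toReal_mono
        (ENNReal.mul_ne_top ENNReal.coe_ne_top (Lp.memLp ξ).2.ne)
        (hk.eLpNorm_applyFun_le (Lp.memLp ξ))
      rwa [ENNReal.toReal_mul, ENNReal.coe_toReal] at h

theorem op_norm_le (hk : IsSchurKernel μ C k) : ‖hk.op‖ ≤ C :=
  LinearMap.mkContinuous_norm_le _ C.2 _

theorem coeFn_op (hk : IsSchurKernel μ C k) (ξ : Lp ℂ 2 μ) :
    hk.op ξ =ᵐ[μ] fun a => ∫ b, k a b * ξ b ∂μ :=
  MemLp.coeFn_toLp (hk.memLp_applyFun (Lp.memLp ξ))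

theorem op_adjoint {C' : ℝ≥0} {k' : Ω → Ω → ℂ} (hk : IsSchurKernel μ C k)
    (hk' : IsSchurKernel μ C' k') (h : ∀ a b, k' a b = conj (k b a)) :
    hk'.op = star hk.op := by
  rw [ContinuousLinearMap.star_eq_adjoint, ContinuousLinearMap.eq_adjoint_iff]
  intro ξ η
  rw [L2.inner_def, L2.inner_def]
  have e1 : ∫ a, inner ℂ (hk'.op ξ a) (η a) ∂μ = ∫ a, ∫ b, k b a * conj (ξ b) * η a ∂μ ∂μ := by
    refine integral_congr_ae ?_
    filter_upwards [hk'.coeFn_op ξ] with a ha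
    rw [ha, RCLike.inner_apply, ← integral_conj, ← integral_const_mul]
    refine integral_congr_ae (Eventually.of_forall fun b => ?_)
    simp only [h, map_mul, Complex.conj_conj]
    ring
  have e2 : ∫ b, inner ℂ (ξ b) (hk.op η b) ∂μ = ∫ b, ∫ a, k b a * conj (ξ b) * η a ∂μ ∂μ := by
    refine integral_congr_ae ?_
    filter_upwards [hk.coeFn_op η] with b hb
    rw [hb, RCLike.inner_apply, ← integral_mul_const]
    refine integral_congr_ae (Eventually.of_forall fun a => ?_)
    simp only
    ring
  rw [e1, e2]
  refine integral_integral_swap ?_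
  have hηm := (Lp.aestronglyMeasurable η)
  have hξm := (Lp.aestronglyMeasurable ξ)
  have hmeas : AEStronglyMeasurable (Function.uncurry fun a b => k b a * conj (ξ b) * η a)
      (μ.prod μ) := by
    refine AEStronglyMeasurable.mul (AEStronglyMeasurable.mul ?_ ?_) hηm.comp_fst
    · exact (hk.measurable.comp measurable_swap).aestronglyMeasurable
    · exact Complex.continuous_conj.comp_aestronglyMeasurable hξm.comp_snd
  refine ⟨hmeas, ?_⟩
  rw [hasFiniteIntegral_iff_enorm, lintegral_prod _ hmeas.enorm]
  have e3 : ∫⁻ a, ∫⁻ b, ‖Function.uncurry (fun a b => k b a * conj (ξ b) * η a) (a, b)‖ₑ ∂μ ∂μ =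
      ∫⁻ a, (∫⁻ b, ‖k' a b‖ₑ * ‖ξ b‖ₑ ∂μ) * ‖η a‖ₑ ∂μ := by
    refine lintegral_congr fun a => ?_
    rw [← lintegral_mul_const' _ _ enorm_ne_top]
    refine lintegral_congr fun b => ?_
    simp only [Function.uncurry, enorm_mul, h, RCLike.enorm_conj]
  rw [e3]
  have hmk : AEMeasurable (fun a => ∫⁻ b, ‖k' a b‖ₑ * ‖ξ b‖ₑ ∂μ) μ := by
    have := (hk'.aestronglyMeasurable_apply hξm).enorm.lintegral_prod_right'
    simpa only [enorm_mul] using this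
  refine (ENNReal.lintegral_mul_le_Lp_mul_Lq μ Real.HolderConjugate.two_two hmk
    hηm.enorm).trans_lt (ENNReal.mul_lt_top ?_ ?_)
  · refine ENNReal.rpow_lt_top_of_nonneg (by norm_num) ?_
    refine ((hk'.abs_bound hξm).trans_lt (ENNReal.mul_lt_top ?_
      (lintegral_sq_lt_top (Lp.memLp ξ)))).ne
    exact ENNReal.rpow_lt_top_of_nonneg (by norm_num) ENNReal.coe_ne_top
  · exact ENNReal.rpow_lt_top_of_nonneg (by norm_num) (lintegral_sq_lt_top (Lp.memLp η)).ne

theorem op_mul {C₁ C₂ : ℝ≥0} {k₁ k₂ : Ω → Ω → ℂ} (hk : IsSchurKernel μ C k)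
    (hk₁ : IsSchurKernel μ C₁ k₁) (hk₂ : IsSchurKernel μ C₂ k₂)
    (h : ∀ᵐ a ∂μ, ∀ᵐ d ∂μ, k a d = ∫ b, k₁ a b * k₂ b d ∂μ) :
    hk.op = hk₁.op * hk₂.op := by
  ext1 ξ
  rw [mul_apply_eq_comp]
  refine Lp.ext ?_
  have hξm := (Lp.aestronglyMeasurable ξ)
  have hmk : AEMeasurable (fun b => ∫⁻ d, ‖k₂ b d‖ₑ * ‖ξ d‖ₑ ∂μ) μ := by
    have := (hk₂.aestronglyMeasurable_apply hξm).enorm.lintegral_prod_right'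
    simpa only [enorm_mul] using this
  have hfin : ∀ᵐ a ∂μ, ∫⁻ b, ‖k₁ a b‖ₑ * (∫⁻ d, ‖k₂ b d‖ₑ * ‖ξ d‖ₑ ∂μ) ∂μ < ∞ := by
    have hb := schur_lintegral (k := fun a b => ‖k₁ a b‖ₑ) hk₁.measurable.enorm hk₁.left hk₁.right hmk
    have hfin2 : ∫⁻ a, (∫⁻ b, ‖k₁ a b‖ₑ * (∫⁻ d, ‖k₂ b d‖ₑ * ‖ξ d‖ₑ ∂μ) ∂μ) ^ (2 : ℝ) ∂μ ≠ ∞ := by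
      refine (hb.trans_lt (ENNReal.mul_lt_top ?_ ((hk₂.abs_bound hξm).trans_lt
        (ENNReal.mul_lt_top ?_ (lintegral_sq_lt_top (Lp.memLp ξ)))))).ne
      · exact ENNReal.rpow_lt_top_of_nonneg (by norm_num) ENNReal.coe_ne_top
      · exact ENNReal.rpow_lt_top_of_nonneg (by norm_num) ENNReal.coe_ne_top
    have hm : AEMeasurable
        (fun a => (∫⁻ b, ‖k₁ a b‖ₑ * (∫⁻ d, ‖k₂ b d‖ₑ * ‖ξ d‖ₑ ∂μ) ∂μ) ^ (2 : ℝ)) μ := by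
      refine AEMeasurable.pow_const ?_ _
      have : AEMeasurable (fun p : Ω × Ω => ‖k₁ p.1 p.2‖ₑ * (∫⁻ d, ‖k₂ p.2 d‖ₑ * ‖ξ d‖ₑ ∂μ))
          (μ.prod μ) := hk₁.measurable.enorm.aemeasurable.mul
            (hmk.comp_quasiMeasurePreserving Measure.quasiMeasurePreserving_snd)
      exact this.lintegral_prod_right'
    filter_upwards [ae_lt_top' hm hfin2] with a ha
    by_contra hne
    rw [not_lt, top_le_iff] at hne
    rw [hne, ENNReal.top_rpow_of_pos (by norm_num)] at ha
    exact lt_irrefl _ ha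
  filter_upwards [hk.coeFn_op ξ, hk₁.coeFn_op (hk₂.op ξ), h, hfin] with a h1 h2 h3 h4
  rw [h1, h2]
  have e1 : ∫ d, k a d * ξ d ∂μ = ∫ d, ∫ b, k₁ a b * k₂ b d * ξ d ∂μ ∂μ := by
    refine integral_congr_ae ?_
    filter_upwards [h3] with d hd
    rw [hd, integral_mul_const]
  have e2 : ∫ b, k₁ a b * (hk₂.op ξ) b ∂μ = ∫ b, ∫ d, k₁ a b * k₂ b d * ξ d ∂μ ∂μ := by
    refine integral_congr_ae ?_
    filter_upwards [hk₂.coeFn_op ξ] with b hb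
    rw [hb, ← integral_const_mul]
    exact integral_congr_ae (Eventually.of_forall fun d => by ring)
  rw [e1, e2]
  refine (integral_integral_swap ?_).symm
  have hmeas : AEStronglyMeasurable (Function.uncurry fun b d => k₁ a b * k₂ b d * ξ d)
      (μ.prod μ) := by
    refine AEStronglyMeasurable.mul (AEStronglyMeasurable.mul ?_ ?_) hξm.comp_snd
    · exact ((hk₁.measurable.comp measurable_prodMk_left).comp measurable_fst).aestronglyMeasurable
    · exact hk₂.measurable.aestronglyMeasurable
  refine ⟨hmeas, ?_⟩
  rw [hasFiniteIntegral_iff_enorm, lintegral_prod _ hmeas.enorm]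
  refine lt_of_eq_of_lt (lintegral_congr fun b => ?_) h4
  rw [← lintegral_const_mul' _ _ enorm_ne_top]
  refine lintegral_congr fun d => ?_
  simp only [Function.uncurry, enorm_mul, mul_assoc]

end IsSchurKernel

end Schur

section Multiplicity

variable {A : Type*} [NonUnitalCStarAlgebra A]

theorem continuous_repr {H : Type*} [NormedAddCommGroup H] [InnerProductSpace ℂ H]
    [CompleteSpace H] (π : A →⋆ₙₐ[ℂ] (H →L[ℂ] H)) : Continuous π :=
  AddMonoidHomClass.continuous_of_bound π 1 fun a => by
    rw [one_mul]; exact NonUnitalStarAlgHom.norm_apply_le π a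

/-- The functional `(π(·)η | η)` on `A`. Mathlib's inner product is conjugate-linear in its first
argument. -/
noncomputable def vectorFunctional {H : Type*} [NormedAddCommGroup H] [InnerProductSpace ℂ H]
    [CompleteSpace H] (π : A →⋆ₙₐ[ℂ] (H →L[ℂ] H)) (η : H) : A →L[ℂ] ℂ :=
  (innerSL ℂ η) ∘L (ContinuousLinearMap.apply ℂ H η) ∘L
    (⟨(π : A →ₗ[ℂ] (H →L[ℂ] H)), continuous_repr π⟩ : A →L[ℂ] (H →L[ℂ] H))

theorem vectorFunctional_apply {H : Type*} [NormedAddCommGroup H] [InnerProductSpace ℂ H]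
    [CompleteSpace H] (π : A →⋆ₙₐ[ℂ] (H →L[ℂ] H)) (η : H) (a : A) :
    vectorFunctional π η a = inner ℂ η (π a η) := rfl

/-- The basic weak* neighbourhoods `{ψ : |ψ(a)| < ε for all a ∈ F}` of zero in the dual of `A`,
for `F ⊆ A` finite and `ε > 0`. -/
def weakStarBase (A : Type*) [NonUnitalCStarAlgebra A] : Set (Set (A →L[ℂ] ℂ)) :=
  {N | ∃ (F : Finset A) (ε : ℝ), 0 < ε ∧ N = {ψ | ∀ a ∈ F, ‖ψ a‖ < ε}}

/-- `Vec(σ, φ, N)`: the unit vectors `η` with `(σ(·)η | η) ∈ φ + N`. -/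
def vecSet {H : Type*} [NormedAddCommGroup H] [InnerProductSpace ℂ H] [CompleteSpace H]
    (σ : A →⋆ₙₐ[ℂ] (H →L[ℂ] H)) (φ : A →L[ℂ] ℂ) (N : Set (A →L[ℂ] ℂ)) : Set H :=
  {η | ‖η‖ = 1 ∧ ∃ ψ ∈ N, vectorFunctional σ η = φ + ψ}

/-- `d(σ, φ, N)`: the supremum of the cardinalities of the finite orthonormal subsets of
`Vec(σ, φ, N)`; it is `0` if that set is empty. -/
noncomputable def vecDim {H : Type*} [NormedAddCommGroup H] [InnerProductSpace ℂ H]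
    [CompleteSpace H] (σ : A →⋆ₙₐ[ℂ] (H →L[ℂ] H)) (φ : A →L[ℂ] ℂ) (N : Set (A →L[ℂ] ℂ)) : ℕ∞ :=
  ⨆ (S : Finset H) (_ : (S : Set H) ⊆ vecSet σ φ N) (_ : Orthonormal ℂ (fun η : S => (η : H))),
    (S.card : ℕ∞)

/-- The lower multiplicity `M_L(φ, {σ_α})` of a net of representations relative to a functional:
the infimum over the basic weak* neighbourhoods `N` of `liminf_α d(σ_α, φ, N)`. -/
noncomputable def lowerMultiplicityAt {Λ : Type*} [Preorder Λ] (φ : A →L[ℂ] ℂ) {H : Λ → Type*}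
    [∀ α, NormedAddCommGroup (H α)] [∀ α, InnerProductSpace ℂ (H α)] [∀ α, CompleteSpace (H α)]
    (σ : ∀ α, A →⋆ₙₐ[ℂ] (H α →L[ℂ] H α)) : ℕ∞ :=
  ⨅ N ∈ weakStarBase A, liminf (fun α => vecDim (σ α) φ N) atTop

/-- The lower multiplicity `M_L(π, {σ_α})` of an irreducible representation `π` relative to a net
`{σ_α}`. The pure states associated with an irreducible `π` are its vector states
`φ = (π(·)η | η)`, `‖η‖ = 1`, and `M_L(φ, {σ_α})` has the same value for all of them; the infimum
over all of them is this common value. -/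
noncomputable def lowerMultiplicity {H₀ : Type*} [NormedAddCommGroup H₀] [InnerProductSpace ℂ H₀]
    [CompleteSpace H₀] (π : A →⋆ₙₐ[ℂ] (H₀ →L[ℂ] H₀)) {Λ : Type*} [Preorder Λ] {H : Λ → Type*}
    [∀ α, NormedAddCommGroup (H α)] [∀ α, InnerProductSpace ℂ (H α)] [∀ α, CompleteSpace (H α)]
    (σ : ∀ α, A →⋆ₙₐ[ℂ] (H α →L[ℂ] H α)) : ℕ∞ :=
  ⨅ (η : H₀) (_ : ‖η‖ = 1), lowerMultiplicityAt (vectorFunctional π η) σ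

end Multiplicity

/-- A sequence tends to infinity if it has no convergent subsequence. -/
def TendsToInfinity {Y : Type*} [TopologicalSpace Y] (y : ℕ → Y) : Prop :=
  ∀ (m : ℕ → ℕ), StrictMono m → ∀ a : Y, ¬ Tendsto (fun n => y (m n)) atTop (𝓝 a)

/-- The sequence `x` of units converges `k`-times to `z` in the orbit space. -/
def TopGroupoid.ConvergesTimes {X G : Type u} [TopologicalSpace X] [TopologicalSpace G]
    (𝒢 : TopGroupoid X G) (k : ℕ) (x : ℕ → X) (z : X) : Prop :=
  ∃ (c : Fin k → ℕ → G) (hs : ∀ i n, 𝒢.s (c i n) = x n),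
    (∀ i, Tendsto (fun n => 𝒢.r (c i n)) atTop (𝓝 z)) ∧
    ∀ i j, i < j → TendsToInfinity fun n => 𝒢.div (c j n) (c i n) ((hs j n).trans (hs i n).symm)

namespace HaarSystem

variable {X G : Type u} [TopologicalSpace X] [TopologicalSpace G] [MeasurableSpace G]
  [BorelSpace G] [T2Space G] [LocallyCompactSpace G] [SecondCountableTopology G]
  {𝒢 : TopGroupoid X G} (L : HaarSystem 𝒢)

/-- The `I`-norm `max (sup_x ∫ |f| dλ_x) (sup_x ∫ |f| dλ^x)`, where `λ^x` is the image of `λ_x`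
under inversion. -/
noncomputable def iNorm (f : C_c(G, ℂ)) : ℝ :=
  max (⨆ x, ∫ a, ‖f a‖ ∂(L.measure x)) (⨆ x, ∫ a, ‖f (𝒢.inv a)‖ ∂(L.measure x))

theorem bddAbove_integral_norm (f : C_c(G, ℂ)) :
    BddAbove (range fun x => ∫ a, ‖f a‖ ∂(L.measure x)) := by
  let F : C_c(G, ℂ) := f.compLeft
    (⟨fun t => ((‖t‖ : ℝ) : ℂ), Complex.continuous_ofReal.comp continuous_norm⟩ : C(ℂ, ℂ))
  have hF : ∀ a, F a = ((‖f a‖ : ℝ) : ℂ) := fun a =>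
    CompactlySupportedContinuousMap.compLeft_apply (by simp) f a
  obtain ⟨C, hC⟩ := (L.hasCompactSupport_integral F).exists_bound_of_continuous
    (L.continuous_integral F)
  refine ⟨C, ?_⟩
  rintro _ ⟨x, rfl⟩
  have h := hC x
  simp only [hF] at h
  rw [integral_complex_ofReal, Complex.norm_real] at h
  exact (le_abs_self _).trans h

theorem integral_norm_le (f : C_c(G, ℂ)) (x : X) : ∫ a, ‖f a‖ ∂(L.measure x) ≤ L.iNorm f :=
  (le_ciSup (L.bddAbove_integral_norm f) x).trans (le_max_left _ _)

theorem invol_apply (f : C_c(G, ℂ)) (a : G) : 𝒢.invol f a = conj (f (𝒢.inv a)) := rfl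

theorem conv_apply (f g : C_c(G, ℂ)) (a : G) :
    L.conv f g a = ∫ b, 𝒢.kern f a b * g b ∂(L.measure (𝒢.s a)) := rfl

theorem integral_norm_invol_le (f : C_c(G, ℂ)) (x : X) :
    ∫ a, ‖𝒢.invol f a‖ ∂(L.measure x) ≤ L.iNorm f := by
  have e : ∀ x, ∫ a, ‖𝒢.invol f a‖ ∂(L.measure x) = ∫ a, ‖f (𝒢.inv a)‖ ∂(L.measure x) := fun x => by
    simp only [invol_apply, RCLike.norm_conj]
  have h := L.bddAbove_integral_norm (𝒢.invol f)
  simp only [e] at h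
  rw [e]
  exact (le_ciSup h x).trans (le_max_right _ _)

theorem iNorm_nonneg (f : C_c(G, ℂ)) : 0 ≤ L.iNorm f :=
  le_max_of_le_left (Real.iSup_nonneg fun _ => integral_nonneg fun _ => norm_nonneg _)

theorem lintegral_kern (f : C_c(G, ℂ)) {x : X} {b : G} (hb : 𝒢.s b = x) :
    ∫⁻ a, ‖𝒢.kern f a b‖ₑ ∂(L.measure x) =
      ENNReal.ofReal (∫ a, ‖f a‖ ∂(L.measure (𝒢.r b))) := by
  have h := L.lintegral_mulRight (𝒢.inv b) (f := fun a => ‖f a‖ₑ) f.continuous.measurable.enorm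
  rw [𝒢.r_inv, 𝒢.s_inv, hb] at h
  have hf : Integrable f (L.measure (𝒢.r b)) :=
    f.continuous.integrable_of_hasCompactSupport f.hasCompactSupport
  rw [ofReal_integral_norm_eq_lintegral_enorm hf, ← h]
  refine lintegral_congr_ae ?_
  filter_upwards [L.ae_s_eq x] with a ha
  rw [TopGroupoid.kern_eq_mulRight (ha.trans hb.symm)]

theorem isSchurKernel (f : C_c(G, ℂ)) (x : X) :
    IsSchurKernel (L.measure x) ⟨L.iNorm f, L.iNorm_nonneg f⟩ (𝒢.kern f) where
  measurable := measurable_kern f.continuous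
  left := by
    filter_upwards [L.ae_s_eq x] with a ha
    have e : ∀ b, ‖𝒢.kern f a b‖ₑ = ‖𝒢.kern (𝒢.invol f) b a‖ₑ := fun b => by
      have h : 𝒢.kern (𝒢.invol f) b a = conj (𝒢.kern f a b) := TopGroupoid.kern_star f b a
      rw [h, RCLike.enorm_conj]
    simp only [e]
    rw [L.lintegral_kern _ ha]
    exact (ENNReal.ofReal_le_ofReal (L.integral_norm_invol_le f _)).trans_eq
      (ENNReal.ofReal_eq_coe_nnreal _)
  right := by
    filter_upwards [L.ae_s_eq x] with b hb
    rw [L.lintegral_kern _ hb]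
    exact (ENNReal.ofReal_le_ofReal (L.integral_norm_le f _)).trans_eq
      (ENNReal.ofReal_eq_coe_nnreal _)

/-- An `I`-norm bounded `*`-representation of the convolution algebra `C_c(G)` on a Hilbert
space. -/
structure IBoundedRep where
  H : Type u
  [normedAddCommGroup : NormedAddCommGroup H]
  [innerProductSpace : InnerProductSpace ℂ H]
  [completeSpace : CompleteSpace H]
  toLin : C_c(G, ℂ) →ₗ[ℂ] (H →L[ℂ] H)
  map_conv : ∀ f g, toLin (L.conv f g) = toLin f * toLin g
  map_invol : ∀ f, toLin (𝒢.invol f) = star (toLin f)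
  norm_le : ∀ f, ‖toLin f‖ ≤ L.iNorm f

attribute [instance] IBoundedRep.normedAddCommGroup IBoundedRep.innerProductSpace
  IBoundedRep.completeSpace

/-- `L^x(f)`: the operator `(L^x(f)ξ)(a) = ∫ f(ab⁻¹) ξ(b) dλ_x(b)` on `L²(G, λ_x)`. -/
noncomputable def inducedOp (x : X) (f : C_c(G, ℂ)) :
    Lp ℂ 2 (L.measure x) →L[ℂ] Lp ℂ 2 (L.measure x) :=
  (L.isSchurKernel f x).op

theorem coeFn_inducedOp (x : X) (f : C_c(G, ℂ)) (ξ : Lp ℂ 2 (L.measure x)) :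
    L.inducedOp x f ξ =ᵐ[L.measure x] fun a => ∫ b, 𝒢.kern f a b * ξ b ∂(L.measure x) :=
  (L.isSchurKernel f x).coeFn_op ξ

theorem kern_conv (f g : C_c(G, ℂ)) {x : X} {a d : G} (ha : 𝒢.s a = x) (hd : 𝒢.s d = x) :
    𝒢.kern (L.conv f g) a d = ∫ b, 𝒢.kern f a b * 𝒢.kern g b d ∂(L.measure x) := by
  have had := ha.trans hd.symm
  rw [TopGroupoid.kern_of_eq had, conv_apply, TopGroupoid.s_div]
  have hm := L.map_mulRight (𝒢.inv d)
  rw [𝒢.r_inv, 𝒢.s_inv, hd] at hm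
  rw [← hm, integral_map (measurable_mulRight _).aemeasurable]
  · refine integral_congr_ae ?_
    filter_upwards [L.ae_s_eq x] with b hb
    have hbd := hb.trans hd.symm
    have e : 𝒢.mulRight (𝒢.inv d) b = 𝒢.div b d hbd := dif_pos (hbd.trans (𝒢.r_inv d).symm)
    rw [e, TopGroupoid.kern_kern, TopGroupoid.kern_of_eq hbd]
  · exact (((measurable_kern f.continuous).comp measurable_prodMk_left).mul
      g.continuous.measurable).aestronglyMeasurable

/-- The representation `L^x` of `C_c(G)`, induced from the point mass at `x`. -/
noncomputable def inducedRep (x : X) : L.IBoundedRep where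
  H := Lp ℂ 2 (L.measure x)
  toLin :=
    { toFun := L.inducedOp x
      map_add' := fun f g => by
        ext1 ξ
        rw [add_apply]
        refine Lp.ext ?_
        filter_upwards [L.coeFn_inducedOp x (f + g) ξ, L.coeFn_inducedOp x f ξ,
          L.coeFn_inducedOp x g ξ, Lp.coeFn_add (L.inducedOp x f ξ) (L.inducedOp x g ξ),
          (L.isSchurKernel f x).ae_integrable (Lp.memLp ξ),
          (L.isSchurKernel g x).ae_integrable (Lp.memLp ξ)] with a h1 h2 h3 h4 h5 h6
        rw [h1, h4, Pi.add_apply, h2, h3, ← integral_add h5 h6]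
        refine integral_congr_ae (Eventually.of_forall fun b => ?_)
        by_cases h : 𝒢.s a = 𝒢.s b
        · simp only [TopGroupoid.kern_of_eq h, CompactlySupportedContinuousMap.add_apply, add_mul]
        · simp only [TopGroupoid.kern_of_ne h, zero_mul, add_zero]
      map_smul' := fun c f => by
        ext1 ξ
        rw [RingHom.id_apply, smul_apply]
        refine Lp.ext ?_
        filter_upwards [L.coeFn_inducedOp x (c • f) ξ, L.coeFn_inducedOp x f ξ,
          Lp.coeFn_smul c (L.inducedOp x f ξ)] with a h1 h2 h3
        rw [h1, h3, Pi.smul_apply, h2, smul_eq_mul, ← integral_const_mul]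
        refine integral_congr_ae (Eventually.of_forall fun b => ?_)
        by_cases h : 𝒢.s a = 𝒢.s b
        · simp only [TopGroupoid.kern_of_eq h, CompactlySupportedContinuousMap.smul_apply,
            smul_eq_mul, mul_assoc]
        · simp only [TopGroupoid.kern_of_ne h, zero_mul, mul_zero] }
  map_conv := fun f g => by
    refine IsSchurKernel.op_mul (L.isSchurKernel (L.conv f g) x) (L.isSchurKernel f x)
      (L.isSchurKernel g x) ?_
    filter_upwards [L.ae_s_eq x] with a ha
    filter_upwards [L.ae_s_eq x] with d hd
    exact L.kern_conv f g ha hd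
  map_invol := fun f => IsSchurKernel.op_adjoint (L.isSchurKernel f x)
    (L.isSchurKernel (𝒢.invol f) x) fun a b => TopGroupoid.kern_star f a b
  norm_le := fun f => (L.isSchurKernel f x).op_norm_le

/-- The `C*`-algebraic product of the algebras `B(H_π)` over all `I`-norm bounded representations
`π` (bounded families with the supremum norm). -/
def RepProd : Type (u + 1) := lp (fun π : L.IBoundedRep => π.H →L[ℂ] π.H) ∞

noncomputable instance : NonUnitalCStarAlgebra L.RepProd :=
  inferInstanceAs (NonUnitalCStarAlgebra (lp (fun π : L.IBoundedRep => π.H →L[ℂ] π.H) ∞))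

/-- The image `(π(f))_π` of `f ∈ C_c(G)` in the product. Its norm is the universal norm
`sup_π ‖π(f)‖`. -/
noncomputable def toProd (f : C_c(G, ℂ)) : L.RepProd :=
  ⟨fun π => π.toLin f, memℓp_infty ⟨L.iNorm f, by rintro _ ⟨π, rfl⟩; exact π.norm_le f⟩⟩

/-- The image of the convolution algebra `C_c(G)` under its universal representation. -/
noncomputable def imageAlg : NonUnitalStarSubalgebra ℂ L.RepProd where
  carrier := range L.toProd
  add_mem' := by
    rintro _ _ ⟨f, rfl⟩ ⟨g, rfl⟩
    exact ⟨f + g, Subtype.ext (funext fun π => map_add π.toLin f g)⟩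
  zero_mem' := ⟨0, Subtype.ext (funext fun π => map_zero π.toLin)⟩
  mul_mem' := by
    rintro _ _ ⟨f, rfl⟩ ⟨g, rfl⟩
    exact ⟨L.conv f g, Subtype.ext (funext fun π => π.map_conv f g)⟩
  smul_mem' := by
    rintro c _ ⟨f, rfl⟩
    exact ⟨c • f, Subtype.ext (funext fun π => map_smul π.toLin c f)⟩
  star_mem' := by
    rintro _ ⟨f, rfl⟩
    exact ⟨𝒢.invol f, Subtype.ext (funext fun π => π.map_invol f)⟩

/-- The (full) groupoid `C*`-algebra `C*(G)`: the completion of `C_c(G)` in the universal norm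
`sup_π ‖π(f)‖`, realised as the closure of `C_c(G)` in its universal representation. -/
def CStar : Type (u + 1) := L.imageAlg.topologicalClosure

noncomputable instance : NonUnitalCStarAlgebra L.CStar :=
  NonUnitalStarSubalgebra.nonUnitalCStarAlgebra L.imageAlg.topologicalClosure
    (h_closed := L.imageAlg.isClosed_topologicalClosure)

/-- The canonical map of `C_c(G)` into `C*(G)`. -/
noncomputable def toCStar (f : C_c(G, ℂ)) : L.CStar :=
  ⟨L.toProd f, L.imageAlg.le_topologicalClosure ⟨f, rfl⟩⟩

variable {L} in
/-- The extension of an `I`-norm bounded representation from `C_c(G)` to `C*(G)`. -/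
noncomputable def IBoundedRep.extend (π : L.IBoundedRep) : L.CStar →⋆ₙₐ[ℂ] (π.H →L[ℂ] π.H) where
  toFun a := a.1.1 π
  map_smul' _ _ := rfl
  map_zero' := rfl
  map_add' _ _ := rfl
  map_mul' _ _ := rfl
  map_star' _ := rfl

variable {L} in
theorem IBoundedRep.extend_toCStar (π : L.IBoundedRep) (f : C_c(G, ℂ)) :
    π.extend (L.toCStar f) = π.toLin f := rfl

theorem norm_toCStar (f : C_c(G, ℂ)) : ‖L.toCStar f‖ = ⨆ π : L.IBoundedRep, ‖π.toLin f‖ :=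
  lp.norm_eq_ciSup (E := fun π : L.IBoundedRep => π.H →L[ℂ] π.H) (L.toProd f)

theorem denseRange_toCStar : DenseRange L.toCStar := by
  have e : (fun a : L.imageAlg.topologicalClosure => (a : L.RepProd)) '' range L.toCStar =
      range L.toProd := (range_comp _ _).symm
  intro a
  refine (closure_subtype (X := L.RepProd)
    (p := fun b => b ∈ L.imageAlg.topologicalClosure) (x := a)).2 ?_
  have h : a.1 ∈ closure (range L.toProd) := a.2
  rw [← e] at h
  exact h

/-- The representation `L^x` of `C*(G)` on `L²(G, λ_x)`. -/
noncomputable def indRep (x : X) :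
    L.CStar →⋆ₙₐ[ℂ] (Lp ℂ 2 (L.measure x) →L[ℂ] Lp ℂ 2 (L.measure x)) :=
  (L.inducedRep x).extend

theorem indRep_toCStar (x : X) (f : C_c(G, ℂ)) : L.indRep x (L.toCStar f) = L.inducedOp x f := rfl

end HaarSystem

/-! ### Vector functionals and orthonormal families -/

section Multiplicity

variable {A : Type*} [NonUnitalCStarAlgebra A]

/-! For `v` in `C_c(G)` and an arrow `c`, let `v_c(a) = v(ac⁻¹)`, a vector of `L²(G, λ_{s(c)})`.
Invariance of the Haar system makes right translation by `c` isometric from `L²(G, λ_{r(c)})` to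
`L²(G, λ_{s(c)})`, and it commutes with left convolution (`inner_translate`, `inducedOp_translate`).
Hence the functional defined by `v_c` depends only on `r(c)`: on `f` it is the integral of `(f ∗ v)
conj(v)` against `λ_{r(c)}`, which is continuous in `r(c)`. Along each of the `k` given sequences of
arrows the ranges tend to `z`, so the functionals of the translates converge weak* to the functional
of `v` in `L^z` (`tendsto_vectorFunctional_translate`), although the arrows themselves need not
converge.

If the supports of `v_c` and `v_d` meet, then `dc⁻¹` lies in the compact set `(supp v)⁻¹ (supp v)`.
Since the quotients of two of the given sequences tend to infinity, the `k` translates are exactly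
orthogonal for all large `n` (`eventually_inner_translate_eq_zero`).

Finally `C_c(G)` is dense in `L²(G, λ_z)` (`denseRange_translate_unit`), so for a unit vector `η`
and a weak* neighbourhood `N` some `v` has its normalised functional within `N` of that of `η`. The
normalised translates then form `k` orthonormal vectors counted by `vecDim` for all large `n`. -/

theorem norm_vectorFunctional_apply_le {H : Type*} [NormedAddCommGroup H] [InnerProductSpace ℂ H]
    [CompleteSpace H] (π : A →⋆ₙₐ[ℂ] (H →L[ℂ] H)) (η : H) (a : A) :
    ‖vectorFunctional π η a‖ ≤ ‖a‖ * ‖η‖ ^ 2 := by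
  rw [vectorFunctional_apply]
  calc ‖inner ℂ η (π a η)‖ ≤ ‖η‖ * ‖π a η‖ := norm_inner_le_norm _ _
    _ ≤ ‖η‖ * (‖a‖ * ‖η‖) := by
        gcongr
        exact (π a).le_of_opNorm_le (NonUnitalStarAlgHom.norm_apply_le π a) η
    _ = ‖a‖ * ‖η‖ ^ 2 := by ring

theorem vectorFunctional_smul {H : Type*} [NormedAddCommGroup H] [InnerProductSpace ℂ H]
    [CompleteSpace H] (π : A →⋆ₙₐ[ℂ] (H →L[ℂ] H)) (t : ℝ) (η : H) (a : A) :
    vectorFunctional π ((t : ℂ) • η) a = ((t ^ 2 : ℝ) : ℂ) * vectorFunctional π η a := by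
  simp only [vectorFunctional_apply, map_smul, inner_smul_left, inner_smul_right,
    Complex.conj_ofReal]
  push_cast
  ring

theorem continuous_vectorFunctional_apply {H : Type*} [NormedAddCommGroup H]
    [InnerProductSpace ℂ H] [CompleteSpace H] (π : A →⋆ₙₐ[ℂ] (H →L[ℂ] H)) (a : A) :
    Continuous fun η => vectorFunctional π η a := by
  simp only [vectorFunctional_apply]
  fun_prop

/-- Vector functionals of norm-bounded sequences of vectors converge pointwise as soon as they do so
on a dense set. -/
theorem tendsto_vectorFunctional_of_denseRange {D : Type*} {j : D → A} (hj : DenseRange j)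
    {H : ℕ → Type*} [∀ n, NormedAddCommGroup (H n)] [∀ n, InnerProductSpace ℂ (H n)]
    [∀ n, CompleteSpace (H n)] (σ : ∀ n, A →⋆ₙₐ[ℂ] (H n →L[ℂ] H n)) (ξ : ∀ n, H n)
    {φ : A →L[ℂ] ℂ} {C : ℝ} (hC : ∀ᶠ n in atTop, ‖ξ n‖ ^ 2 ≤ C)
    (h : ∀ d, Tendsto (fun n => vectorFunctional (σ n) (ξ n) (j d)) atTop (𝓝 (φ (j d)))) (a : A) :
    Tendsto (fun n => vectorFunctional (σ n) (ξ n) a) atTop (𝓝 (φ a)) := by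
  have hC0 : 0 ≤ C := by
    obtain ⟨n, hn⟩ := hC.exists
    exact (sq_nonneg _).trans hn
  rw [Metric.tendsto_nhds]
  intro ε hε
  have hM : 0 < C + ‖φ‖ + 1 := by positivity
  -- Replacing `a` by `j d` costs at most `C * ‖a - j d‖` in the vector functionals and `‖φ‖ * ‖a -
  -- j d‖` in the limit, together less than `ε / 2`. The summand `1` only keeps the denominator
  -- positive.
  obtain ⟨d, hd⟩ := hj.exists_dist_lt a (ε := ε / 2 / (C + ‖φ‖ + 1)) (by positivity)
  rw [dist_eq_norm, lt_div_iff₀ hM] at hd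
  filter_upwards [hC, Metric.tendsto_nhds.1 (h d) (ε / 2) (half_pos hε)] with n h1 h2
  rw [dist_eq_norm] at h2 ⊢
  have e : vectorFunctional (σ n) (ξ n) a - φ a = vectorFunctional (σ n) (ξ n) (a - j d) +
      (vectorFunctional (σ n) (ξ n) (j d) - φ (j d)) - φ (a - j d) := by
    rw [map_sub, map_sub]; ring
  have h3 : ‖vectorFunctional (σ n) (ξ n) (a - j d)‖ ≤ ‖a - j d‖ * C :=
    (norm_vectorFunctional_apply_le _ _ _).trans (by gcongr)
  have h4 : ‖φ (a - j d)‖ ≤ ‖φ‖ * ‖a - j d‖ := φ.le_opNorm _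
  rw [e]
  have h5 := norm_sub_le (vectorFunctional (σ n) (ξ n) (a - j d) +
      (vectorFunctional (σ n) (ξ n) (j d) - φ (j d))) (φ (a - j d))
  have h6 := norm_add_le (vectorFunctional (σ n) (ξ n) (a - j d))
    (vectorFunctional (σ n) (ξ n) (j d) - φ (j d))
  nlinarith [norm_nonneg (a - j d)]

/-- Passes from indexed families to the finite sets over which `vecDim` is a supremum: orthonormal
families are linearly independent, hence injective, so no element is lost in the image. -/
theorem le_vecDim {H : Type*} [NormedAddCommGroup H] [InnerProductSpace ℂ H] [CompleteSpace H]
    {σ : A →⋆ₙₐ[ℂ] (H →L[ℂ] H)} {φ : A →L[ℂ] ℂ} {N : Set (A →L[ℂ] ℂ)} {k : ℕ} {e : Fin k → H}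
    (he : Orthonormal ℂ e) (hN : ∀ i, e i ∈ vecSet σ φ N) : (k : ℕ∞) ≤ vecDim σ φ N := by
  classical
  have hinj := he.linearIndependent.injective
  have hcard : (Finset.univ.image e).card = k := by
    rw [Finset.card_image_of_injective _ hinj, Finset.card_univ, Fintype.card_fin]
  have hS : ((Finset.univ.image e : Finset H) : Set H) = range e := by simp
  refine le_iSup_of_le (Finset.univ.image e) (le_iSup₂_of_le ?_ ?_ (by rw [hcard]))
  · rw [hS]
    rintro _ ⟨i, rfl⟩
    exact hN i
  · have hmem : ∀ η : (Finset.univ.image e : Finset H), ∃ i, e i = η := by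
      rintro ⟨η, hη⟩
      simpa using hη
    choose f hf using hmem
    have h := he.comp f fun a b hab => Subtype.ext (by rw [← hf a, ← hf b, hab])
    rwa [show e ∘ f = fun η : (Finset.univ.image e : Finset H) => (η : H) from funext hf] at h

end Multiplicity

namespace HaarSystem

variable {X G : Type u} [TopologicalSpace X] [TopologicalSpace G] [MeasurableSpace G]
  [BorelSpace G] [T2Space G] [LocallyCompactSpace G] [SecondCountableTopology G]
  {𝒢 : TopGroupoid X G} (L : HaarSystem 𝒢)

/-! ### Right translates as vectors in L²(G, λ_x) -/

theorem integral_mulRight {f : G → ℂ} (hf : Continuous f) (c : G) :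
    ∫ a, f (𝒢.mulRight c a) ∂(L.measure (𝒢.r c)) = ∫ a, f a ∂(L.measure (𝒢.s c)) := by
  rw [← L.map_mulRight c, integral_map (measurable_mulRight c).aemeasurable
    hf.aestronglyMeasurable]

/-- By invariance `λ_{r(c)}` is the image of `λ_x` under `a ↦ ac⁻¹`, so square integrability of `v`
pulls back. The conventions off `s⁻¹(x)` differ (`kern` is zero there, `mulRight` is the identity),
hence the passage through an almost everywhere equality. -/
theorem memLp_kern (v : C_c(G, ℂ)) {c : G} {x : X} (hc : 𝒢.s c = x) :
    MemLp (fun a => 𝒢.kern v a c) 2 (L.measure x) := by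
  have hm := L.map_mulRight (𝒢.inv c)
  rw [𝒢.r_inv, 𝒢.s_inv, hc] at hm
  have h : MemLp v 2 (L.measure (𝒢.r c)) :=
    v.continuous.memLp_of_hasCompactSupport v.hasCompactSupport
  rw [← hm] at h
  have h2 := (memLp_map_measure_iff h.1 (measurable_mulRight _).aemeasurable).1 h
  refine (memLp_congr_ae ?_).1 h2
  filter_upwards [L.ae_s_eq x] with a ha
  exact (TopGroupoid.kern_eq_mulRight (ha.trans hc.symm)).symm

/-- The right translate `a ↦ v(ac⁻¹)` of `v ∈ C_c(G)`, as a vector in `L²(G, λ_{s(c)})`. -/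
noncomputable def translate (v : C_c(G, ℂ)) {c : G} {x : X} (hc : 𝒢.s c = x) :
    Lp ℂ 2 (L.measure x) :=
  (L.memLp_kern v hc).toLp _

theorem coeFn_translate (v : C_c(G, ℂ)) {c : G} {x : X} (hc : 𝒢.s c = x) :
    L.translate v hc =ᵐ[L.measure x] fun a => 𝒢.kern v a c :=
  MemLp.coeFn_toLp _

/-- Convolution on the left commutes with translation on the right; the analytic content is
`kern_conv`. -/
theorem inducedOp_translate (f v : C_c(G, ℂ)) {c : G} {x : X} (hc : 𝒢.s c = x) :
    L.inducedOp x f (L.translate v hc) = L.translate (L.conv f v) hc := by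
  refine Lp.ext ?_
  filter_upwards [L.coeFn_inducedOp x f (L.translate v hc), L.coeFn_translate (L.conv f v) hc,
    L.ae_s_eq x] with a h1 h2 h3
  rw [h1, h2, L.kern_conv f v h3 hc]
  refine integral_congr_ae ?_
  filter_upwards [L.coeFn_translate v hc] with b hb
  rw [hb]

/-- Right translation preserves inner products, by invariance under `c⁻¹`. The point is that the
right-hand side involves `c` only through its range. -/
theorem inner_translate (v w : C_c(G, ℂ)) {c : G} {x : X} (hc : 𝒢.s c = x) :
    inner ℂ (L.translate v hc) (L.translate w hc) =
      ∫ a, w a * conj (v a) ∂(L.measure (𝒢.r c)) := by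
  have h := L.integral_mulRight (f := fun a => w a * conj (v a))
    (w.continuous.mul (Complex.continuous_conj.comp v.continuous)) (𝒢.inv c)
  rw [𝒢.r_inv, 𝒢.s_inv, hc] at h
  rw [← h, L2.inner_def]
  refine integral_congr_ae ?_
  filter_upwards [L.coeFn_translate v hc, L.coeFn_translate w hc, L.ae_s_eq x] with a h1 h2 h3
  rw [h1, h2, RCLike.inner_apply, TopGroupoid.kern_eq_mulRight (h3.trans hc.symm),
    TopGroupoid.kern_eq_mulRight (h3.trans hc.symm)]

/-! ### Convergence of the vector functionals of translates -/

theorem continuous_integral_mul_conj (v w : C_c(G, ℂ)) :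
    Continuous fun y => ∫ a, w a * conj (v a) ∂(L.measure y) :=
  L.continuous_integral ⟨⟨fun a => w a * conj (v a),
    w.continuous.mul (Complex.continuous_conj.comp v.continuous)⟩,
    w.hasCompactSupport.mul_right⟩

/-- Only the ranges are required to converge: the inner products live in varying Hilbert spaces, but
are values of one continuous function on the unit space. -/
theorem tendsto_inner_translate (v w : C_c(G, ℂ)) {c : ℕ → G} {x : ℕ → X}
    (hc : ∀ n, 𝒢.s (c n) = x n) {d : G} {z : X} (hd : 𝒢.s d = z)
    (h : Tendsto (fun n => 𝒢.r (c n)) atTop (𝓝 (𝒢.r d))) :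
    Tendsto (fun n => inner ℂ (L.translate v (hc n)) (L.translate w (hc n))) atTop
      (𝓝 (inner ℂ (L.translate v hd) (L.translate w hd))) := by
  simp only [inner_translate]
  exact (L.continuous_integral_mul_conj v w).continuousAt.tendsto.comp h

theorem tendsto_norm_translate (v : C_c(G, ℂ)) {c : ℕ → G} {x : ℕ → X}
    (hc : ∀ n, 𝒢.s (c n) = x n) {d : G} {z : X} (hd : 𝒢.s d = z)
    (h : Tendsto (fun n => 𝒢.r (c n)) atTop (𝓝 (𝒢.r d))) :
    Tendsto (fun n => ‖L.translate v (hc n)‖) atTop (𝓝 ‖L.translate v hd‖) := by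
  have h1 := (Complex.continuous_re.tendsto _).comp (L.tendsto_inner_translate v v hc hd h)
  simp only [norm_eq_sqrt_re_inner (𝕜 := ℂ)]
  exact h1.sqrt

theorem tendsto_vectorFunctional_translate (v : C_c(G, ℂ)) {c : ℕ → G} {x : ℕ → X}
    (hc : ∀ n, 𝒢.s (c n) = x n) {d : G} {z : X} (hd : 𝒢.s d = z)
    (h : Tendsto (fun n => 𝒢.r (c n)) atTop (𝓝 (𝒢.r d))) (b : L.CStar) :
    Tendsto (fun n => vectorFunctional (L.indRep (x n)) (L.translate v (hc n)) b) atTop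
      (𝓝 (vectorFunctional (L.indRep z) (L.translate v hd) b)) := by
  have hn := (L.tendsto_norm_translate v hc hd h).pow 2
  -- The squared norms converge, so they are eventually at most their limit plus one. This uniform
  -- bound reduces the claim to `f` in `C_c(G)`, where the functional is the inner product of the
  -- translates of `v` and `f ∗ v`.
  refine tendsto_vectorFunctional_of_denseRange L.denseRange_toCStar
    (fun n => L.indRep (x n)) (fun n => L.translate v (hc n))
    (hn.eventually (eventually_le_nhds (lt_add_one _))) (fun f => ?_) b
  simp only [vectorFunctional_apply, indRep_toCStar, inducedOp_translate]
  exact L.tendsto_inner_translate v _ hc hd h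

/-- Translation by a unit is trivial, so this is the density of `C_c(G)` in `L²` of the regular
measure `λ_z`. -/
theorem denseRange_translate_unit (z : X) :
    DenseRange fun v : C_c(G, ℂ) => L.translate v (𝒢.s_unit z) := by
  intro η
  rw [Metric.mem_closure_range_iff]
  intro ε hε
  -- The approximation is within a non-strict bound; `ε / 2` makes the final inequality strict.
  obtain ⟨g, hg, hgε, hgc, -⟩ := (Lp.memLp η).exists_hasCompactSupport_eLpNorm_sub_le
    (by norm_num) (ε := ENNReal.ofReal (ε / 2)) (by simpa using hε)
  refine ⟨⟨⟨g, hgc⟩, hg⟩, ?_⟩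
  have e : eLpNorm (⇑η - ⇑(L.translate ⟨⟨g, hgc⟩, hg⟩ (𝒢.s_unit z))) 2 (L.measure z) =
      eLpNorm (⇑η - g) 2 (L.measure z) := by
    refine eLpNorm_congr_ae ?_
    filter_upwards [L.coeFn_translate ⟨⟨g, hgc⟩, hg⟩ (𝒢.s_unit z), L.ae_s_eq z] with a h1 h2
    have h3 : 𝒢.s a = 𝒢.s (𝒢.unit z) := by rw [h2, 𝒢.s_unit]
    have h4 : 𝒢.div a (𝒢.unit z) h3 = a := by
      have h5 := TopGroupoid.mul_inv_mul a (𝒢.unit z) h3 (TopGroupoid.s_div _ _ _)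
      rwa [TopGroupoid.mul_unit'] at h5
    rw [Pi.sub_apply, Pi.sub_apply, h1, TopGroupoid.kern_of_eq h3, h4]
    rfl
  rw [Lp.dist_def, e]
  refine lt_of_le_of_lt (ENNReal.toReal_mono ENNReal.ofReal_ne_top hgε) ?_
  rw [ENNReal.toReal_ofReal (by positivity)]
  linarith

/-! ### Orthogonality of translates -/

/-- Translates of `v` are orthogonal unless `dc⁻¹` lies in the compact set `(supp v)⁻¹ (supp v)`. -/
theorem exists_isCompact_inner_translate_eq_zero (v : C_c(G, ℂ)) :
    ∃ K : Set G, IsCompact K ∧ ∀ {c d : G} {x : X} (hc : 𝒢.s c = x) (hd : 𝒢.s d = x),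
      𝒢.div d c (hd.trans hc.symm) ∉ K → inner ℂ (L.translate v hc) (L.translate v hd) = 0 := by
  have hK := v.hasCompactSupport.isCompact.image 𝒢.continuous_inv
  have hS : IsCompact {p : {p : G × G // 𝒢.s p.1 = 𝒢.s p.2} |
      p.1 ∈ (𝒢.inv '' tsupport v) ×ˢ (𝒢.inv '' tsupport v)} :=
    𝒢.isClosed_eq_s.isClosedEmbedding_subtypeVal.isCompact_preimage (hK.prod hK)
  -- The compact set consists of the quotients `pq⁻¹` with `p`, `q` in `(supp v)⁻¹` of equal source.
  -- Restricting to the closed set of such pairs preserves compactness.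
  refine ⟨_, hS.image 𝒢.continuous_div, fun {c d x} hc hd hn => ?_⟩
  rw [L2.inner_def]
  refine integral_eq_zero_of_ae ?_
  filter_upwards [L.coeFn_translate v hc, L.coeFn_translate v hd, L.ae_s_eq x] with a h1 h2 h3
  have hac := h3.trans hc.symm
  have had := h3.trans hd.symm
  rw [h1, h2, RCLike.inner_apply, TopGroupoid.kern_of_eq hac, TopGroupoid.kern_of_eq had]
  by_contra hne
  have hvc : v (𝒢.div a c hac) ≠ 0 := fun e => hne (by simp [e])
  have hvd : v (𝒢.div a d had) ≠ 0 := fun e => hne (by simp [e])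
  -- If the integrand is nonzero at `a`, then `ac⁻¹` and `ad⁻¹` lie in `supp v`. Take `p = da⁻¹` and
  -- `q = ca⁻¹`, their inverses; then `pq⁻¹ = dc⁻¹`, as `a` cancels.
  refine hn ⟨⟨(𝒢.div d a had.symm, 𝒢.div c a hac.symm), by
    rw [TopGroupoid.s_div, TopGroupoid.s_div]⟩, ⟨?_, ?_⟩, TopGroupoid.div_div_div d c a had.symm hac.symm _⟩
  · exact ⟨_, subset_tsupport _ hvd, TopGroupoid.inv_div _ _ _⟩
  · exact ⟨_, subset_tsupport _ hvc, TopGroupoid.inv_div _ _ _⟩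

/-- Otherwise the quotients would return infinitely often to a fixed compact set, and sequential
compactness would give a convergent subsequence. -/
theorem eventually_inner_translate_eq_zero (v : C_c(G, ℂ)) {c d : ℕ → G} {x : ℕ → X}
    (hc : ∀ n, 𝒢.s (c n) = x n) (hd : ∀ n, 𝒢.s (d n) = x n)
    (h : TendsToInfinity fun n => 𝒢.div (d n) (c n) ((hd n).trans (hc n).symm)) :
    ∀ᶠ n in atTop, inner ℂ (L.translate v (hc n)) (L.translate v (hd n)) = 0 := by
  obtain ⟨K, hK, hv⟩ := L.exists_isCompact_inner_translate_eq_zero v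
  by_contra hne
  have hf : ∃ᶠ n in atTop, 𝒢.div (d n) (c n) ((hd n).trans (hc n).symm) ∈ K := by
    refine (not_eventually.1 hne).mono fun n hn => ?_
    by_contra hnK
    exact hn (hv (hc n) (hd n) hnK)
  obtain ⟨a, -, m, hm, ha⟩ := hK.isSeqCompact.subseq_of_frequently_in hf
  exact h m hm a ha

end HaarSystem

/-! ### The lower bound for the multiplicity -/

theorem mainTheorem5 {X G : Type u} [TopologicalSpace X] [TopologicalSpace G] [T2Space G]
    [LocallyCompactSpace G] [SecondCountableTopology G] [MeasurableSpace G] [BorelSpace G]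
    (𝒢 : TopGroupoid X G) (h𝒢 : 𝒢.IsPrincipal) (L : HaarSystem 𝒢) (k : ℕ) (hk : 0 < k)
    (z : X) (x : ℕ → X) (hx : 𝒢.ConvergesTimes k x z) :
    (k : ℕ∞) ≤ lowerMultiplicity (L.indRep z) (fun n => L.indRep (x n)) := by
  obtain ⟨c, hs, hr, hinf⟩ := hx
  refine le_iInf₂ fun η hη => le_iInf₂ fun N hN => ?_
  obtain ⟨F, ε, hε, rfl⟩ := hN
  have hη0 : η ≠ 0 := fun e => by simp [e] at hη
  -- The factor `‖·‖⁻¹ ^ 2` normalises the functional, since vector functionals scale quadratically;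
  -- `v` itself need not have norm one.
  obtain ⟨v, hv0, hvF⟩ : ∃ v : C_c(G, ℂ), L.translate v (𝒢.s_unit z) ≠ 0 ∧
      ∀ b ∈ F, ‖(((‖L.translate v (𝒢.s_unit z)‖⁻¹ ^ 2 : ℝ) : ℂ) *
        vectorFunctional (L.indRep z) (L.translate v (𝒢.s_unit z)) b) -
          vectorFunctional (L.indRep z) η b‖ < ε := by
    -- At `ξ = η` the difference vanishes because `‖η‖ = 1`. By continuity the strict bound holds on
    -- a neighbourhood of `η`, which the dense range meets.
    have hU : ∀ᶠ ξ in 𝓝 η, ξ ≠ 0 ∧ ∀ b ∈ F, ‖(((‖ξ‖⁻¹ ^ 2 : ℝ) : ℂ) *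
        vectorFunctional (L.indRep z) ξ b) - vectorFunctional (L.indRep z) η b‖ < ε := by
      refine (eventually_ne_nhds hη0).and (F.eventually_all.2 fun b _ => ?_)
      have hc : ContinuousAt (fun ξ => ‖(((‖ξ‖⁻¹ ^ 2 : ℝ) : ℂ) *
          vectorFunctional (L.indRep z) ξ b) - vectorFunctional (L.indRep z) η b‖) η :=
        (((Complex.continuous_ofReal.continuousAt.comp
          ((continuous_norm.continuousAt.inv₀ (norm_ne_zero_iff.2 hη0)).pow 2)).mul
          (continuous_vectorFunctional_apply _ b).continuousAt).sub continuousAt_const).norm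
      exact hc.eventually_lt continuousAt_const (by simpa [hη] using hε)
    obtain ⟨v, hv⟩ := (L.denseRange_translate_unit z).exists_mem_open isOpen_interior
      ⟨η, mem_interior_iff_mem_nhds.2 hU⟩
    exact ⟨v, (interior_subset hv :)⟩
  have hr' : ∀ i, Tendsto (fun n => 𝒢.r (c i n)) atTop (𝓝 (𝒢.r (𝒢.unit z))) := fun i => by
    rw [𝒢.r_unit]
    exact hr i
  have hnorm : ∀ i, Tendsto (fun n => ‖L.translate v (hs i n)‖) atTop
      (𝓝 ‖L.translate v (𝒢.s_unit z)‖) := fun i =>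
    L.tendsto_norm_translate v (hs i) (𝒢.s_unit z) (hr' i)
  have hne := norm_ne_zero_iff.2 hv0
  have h1 : ∀ᶠ n in atTop, ∀ i, ‖L.translate v (hs i n)‖ ≠ 0 :=
    eventually_all.2 fun i => (hnorm i).eventually_ne hne
  have h2 : ∀ᶠ n in atTop, ∀ i, ∀ b ∈ F, ‖(((‖L.translate v (hs i n)‖⁻¹ ^ 2 : ℝ) : ℂ) *
      vectorFunctional (L.indRep (x n)) (L.translate v (hs i n)) b) -
        vectorFunctional (L.indRep z) η b‖ < ε := by
    -- The normalised functionals of the translates converge to that of `v` at `z`, so the strict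
    -- inequality `hvF` persists for large `n`; finitely many `i` and `b` are involved.
    refine eventually_all.2 fun i => F.eventually_all.2 fun b hb => ?_
    have ht := ((((Complex.continuous_ofReal.tendsto _).comp (((hnorm i).inv₀ hne).pow 2)).mul
      (L.tendsto_vectorFunctional_translate v (hs i) (𝒢.s_unit z) (hr' i) b)).sub_const
        (vectorFunctional (L.indRep z) η b)).norm
    exact ht.eventually_lt_const (hvF b hb)
  have h3 : ∀ᶠ n in atTop, ∀ i j, i < j →
      inner ℂ (L.translate v (hs i n)) (L.translate v (hs j n)) = 0 := by
    refine eventually_all.2 fun i => eventually_all.2 fun j => ?_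
    by_cases hij : i < j
    · filter_upwards [L.eventually_inner_translate_eq_zero v (hs i) (hs j) (hinf i j hij)] with n hn _
      exact hn
    · exact Eventually.of_forall fun n h => absurd h hij
  refine le_liminf_of_le (by isBoundedDefault) ?_
  filter_upwards [h1, h2, h3] with n h1 h2 h3
  have hunit : ∀ i, ‖((‖L.translate v (hs i n)‖⁻¹ : ℝ) : ℂ) • L.translate v (hs i n)‖ = 1 :=
    fun i => by
      rw [norm_smul, Complex.norm_real, norm_inv, norm_norm, inv_mul_cancel₀ (h1 i)]
  -- The element of the neighbourhood required by `vecSet` is the difference between the functional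
  -- of the normalised translate and that of `η`; unification finds it from `add_sub_cancel`.
  refine le_vecDim (e := fun i => ((‖L.translate v (hs i n)‖⁻¹ : ℝ) : ℂ) • L.translate v (hs i n))
    ⟨hunit, fun i j hij => ?_⟩ fun i => ⟨hunit i, _, ?_, (add_sub_cancel _ _).symm⟩
  · have h4 : inner ℂ (L.translate v (hs i n)) (L.translate v (hs j n)) = 0 := by
      rcases lt_or_gt_of_ne hij with h | h
      · exact h3 i j h
      · exact inner_eq_zero_symm.1 (h3 j i h)
    change inner ℂ (_ • _) (_ • _) = 0
    rw [inner_smul_left, inner_smul_right, h4, mul_zero, mul_zero]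
  · intro b hb
    rw [sub_apply, vectorFunctional_smul]
    exact h2 i b hb
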